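/- Let $\Gamma\subset\mathrm{SL}(2,\mathbb R)$ be a discrete subgroup with $-1\in\Gamma$ such that $\Gamma\backslash\mathbb H$ has finite hyperbolic area and has a cusp of width one at infinity, i.e. $\begin{pmatrix}1&x\\0&1\end{pmatrix}\in\Gamma$ if and only if $x\in\mathbb Z$. Let $\mathcal F_\Gamma\subset\mathbb H$ be a fundamental domain for the action of $\Gamma$ on $\mathbb H$ by Möbius transformations, and let $\operatorname{vol}_{\mathbb H}$ be the measure $dx\,dy/y^2$. Write $$n(s)=\begin{pmatrix}1&s\\0&1\end{pmatrix},\qquad a(t)=\begin{pmatrix}e^{t/2}&0\\0&e^{-t/2}\end{pmatrix}.$$ On $\mathcal X=\Gamma\backslash\mathrm{SL}(2,\mathbb R)$ consider the geodesic flow $\varphi_t(x)=x\,a(t)$, the unstable horocycle flow $h^+_r(x)=x\begin{pmatrix}1&0\\-r&1\end{pmatrix}$ and the stable horocycle flow $h^-_s(x)=x\,n(s)$. Let $\mathcal C=\{h^-_s(\Gamma 1):s\in\mathbb R\}$, a closed stable horocycle of length one, and let $\mathcal H(0)=\bigcup_{t\ge 0}\varphi_t(\mathcal C)$, a section which is parametrised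 by $\Sigma=[0,1)\times[0,\infty)$ through $\iota_0(s,t)=\varphi_t(h^-_s(\Gamma 1))=\Gamma\, n(s)a(t)$. For $w\in\Sigma$ let $$\eta_1(w)=\inf\{r>0: h^+_r(\iota_0(w))\in\mathcal H(0)\},\qquad \eta_{-1}(w)=\inf\{r>0: h^+_{-r}(\iota_0(w))\in\mathcal H(0)\}$$ be the first forward and backward return times, with values in $[0,\infty]$. Let $d\nu(s,t)=e^{-t}\,dt\,ds$ on $\Sigma$, let $\overline\eta_1=\int_\Sigma\eta_1\,d\nu\in[0,\infty]$ be the mean return time, and for $r>0$, $w\in\Sigma$ let $$\Psi(r,w)=\frac1{\overline\eta_1}\,\mathbb 1\big(r<\eta_{-1}(w)\big)$$ be the limit density (of the rescaled first hitting time and its impact parameter). Finally let $\mathcal P_\Gamma=(0,1)\Gamma\subset\mathbb R^2$ and, for $r>0$, $\Delta_{-r}=\{u\in\mathbb R^2: -r u_2\le u_1<0,\ 0<u_2\le 1\}$. Then for all $r>0$ and $(s,t)\in\Sigma$, $$\Psi(r,s,t)=\frac1{\overline\eta_1}\,\mathbb 1\big(\mathcal P_\Gamma\, n(s)\,a(t)\cap\Delta_{-r}=\emptyset\big).$$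 Moreover $\eta_1$ is Borel measurable, and $$\overline\eta_1=\pi\operatorname{vol}_{\mathbb H}(\mathcal F_\Gamma)<\infty .$$ -/

import Mathlib

open MeasureTheory
open scoped MatrixGroups ENNReal

namespace Horocycle

noncomputable section

/-- The diagonal matrix `a(t) = diag (e^{t/2}, e^{-t/2})`. -/
def aMat (t : ℝ) : SL(2, ℝ) :=
  ⟨!![Real.exp (t / 2), 0; 0, Real.exp (-t / 2)], by
    rw [Matrix.det_fin_two_of, ← Real.exp_add, neg_div, add_neg_cancel, Real.exp_zero]
    ring⟩

/-- The upper triangular unipotent matrix `n(s) = (1 s; 0 1)`. -/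
def nMat (s : ℝ) : SL(2, ℝ) :=
  ⟨!![1, s; 0, 1], by simp [Matrix.det_fin_two_of]⟩

/-- The lower triangular unipotent matrix `(1 0; r 1)`. -/
def lowMat (r : ℝ) : SL(2, ℝ) :=
  ⟨!![1, 0; r, 1], by simp [Matrix.det_fin_two_of]⟩

/-- The unit tangent bundle `𝒳 = Γ \ SL(2,ℝ)` of `𝒴 = Γ \ ℍ`: the space of cosets `Γ g`. -/
def UnitTangentBundle (Γ : Subgroup SL(2, ℝ)) : Type :=
  Quotient (QuotientGroup.rightRel Γ)

/-- The point `Γ g` of `𝒳`. -/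
def toX (Γ : Subgroup SL(2, ℝ)) (g : SL(2, ℝ)) : UnitTangentBundle Γ :=
  Quotient.mk (QuotientGroup.rightRel Γ) g

/-- Right multiplication `Γ g ↦ Γ g h` on `𝒳`. -/
def rightMul (Γ : Subgroup SL(2, ℝ)) (h : SL(2, ℝ)) :
    UnitTangentBundle Γ → UnitTangentBundle Γ :=
  Quotient.map (fun g => g * h) (by
    intro a b hab
    have hab' : QuotientGroup.rightRel Γ a b := hab
    change QuotientGroup.rightRel Γ (a * h) (b * h)
    rw [QuotientGroup.rightRel_apply] at hab' ⊢
    simpa [mul_assoc] using hab')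

/-- The geodesic flow `φ_t (Γ g) = Γ g a(t)`. -/
def geodesicFlow (Γ : Subgroup SL(2, ℝ)) (t : ℝ) : UnitTangentBundle Γ → UnitTangentBundle Γ :=
  rightMul Γ (aMat t)

/-- The unstable horocycle flow `h⁺_s (Γ g) = Γ g (1 0; -s 1)`. -/
def unstableFlow (Γ : Subgroup SL(2, ℝ)) (s : ℝ) : UnitTangentBundle Γ → UnitTangentBundle Γ :=
  rightMul Γ (lowMat (-s))

/-- The stable horocycle flow `h⁻_s (Γ g) = Γ g (1 s; 0 1)`. -/
def stableFlow (Γ : Subgroup SL(2, ℝ)) (s : ℝ) : UnitTangentBundle Γ → UnitTangentBundle Γ :=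
  rightMul Γ (nMat s)

/-- `Γ` has a cusp of width one at infinity: the elements `(1 x; 0 1)` of `Γ` are exactly those
with `x ∈ ℤ`. -/
def HasWidthOneCuspAtInfinity (Γ : Subgroup SL(2, ℝ)) : Prop :=
  ∀ x : ℝ, nMat x ∈ Γ ↔ ∃ m : ℤ, x = m

/-- The stable horocycle `𝒞 = {h⁻_s (Γ 1) : s ∈ ℝ}` around the cusp at infinity; it is closed of
length one if that cusp has width one. -/
def closedHorocycle (Γ : Subgroup SL(2, ℝ)) : Set (UnitTangentBundle Γ) :=
  Set.range fun s : ℝ => stableFlow Γ s (toX Γ 1)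

/-- The Poincaré section `ℋ(R) = {φ_t (𝒞) : t ≥ R}`. -/
def section' (Γ : Subgroup SL(2, ℝ)) (R : ℝ) : Set (UnitTangentBundle Γ) :=
  {x | ∃ t : ℝ, R ≤ t ∧ ∃ c ∈ closedHorocycle Γ, x = geodesicFlow Γ t c}

/-- The parameter space `Σ = [0,1) × [0,∞)`. -/
def paramSpace : Set (ℝ × ℝ) := Set.Ico 0 1 ×ˢ Set.Ici 0

/-- The parametrisation `ι_R (s,t) = φ_{t+R} (h⁻_s (Γ 1))` of `ℋ(R)`, for `(s,t) ∈ Σ`. -/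
def embed (Γ : Subgroup SL(2, ℝ)) (R : ℝ) (w : ℝ × ℝ) : UnitTangentBundle Γ :=
  geodesicFlow Γ (w.2 + R) (stableFlow Γ w.1 (toX Γ 1))

/-- The first return time `η₁(w) ∈ [0,∞]` of `ι_0(w)` to `ℋ(0)` under the unstable horocycle flow:
the infimum of the `r > 0` with `h⁺_r (ι_0 w) ∈ ℋ(0)` (and `∞` if there are none). -/
def returnTime (Γ : Subgroup SL(2, ℝ)) (w : ℝ × ℝ) : ℝ≥0∞ :=
  sInf {a | ∃ r : ℝ, 0 < r ∧ unstableFlow Γ r (embed Γ 0 w) ∈ section' Γ 0 ∧ a = ENNReal.ofReal r}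

/-- The first backwards return time `η₋₁(w) ∈ [0,∞]` to `ℋ(0)`. -/
def backReturnTime (Γ : Subgroup SL(2, ℝ)) (w : ℝ × ℝ) : ℝ≥0∞ :=
  sInf {a | ∃ r : ℝ, 0 < r ∧ unstableFlow Γ (-r) (embed Γ 0 w) ∈ section' Γ 0 ∧
    a = ENNReal.ofReal r}

/-- The measure `dν(s,t) = e^{-t} dt ds` on `Σ`, as a measure on `ℝ × ℝ` carried by `Σ`. -/
def nu : Measure (ℝ × ℝ) :=
  (volume.restrict paramSpace).withDensity fun w => ENNReal.ofReal (Real.exp (-w.2))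

/-- The mean return time `η̄₁ = ∫_Σ η₁ dν ∈ [0,∞]`. -/
def meanReturnTime (Γ : Subgroup SL(2, ℝ)) : ℝ≥0∞ :=
  ∫⁻ w, returnTime Γ w ∂nu

open Classical in
/-- The indicator `𝟙(p)` of a proposition: `1` if `p` holds and `0` otherwise. -/
def ind (p : Prop) : ℝ := if p then 1 else 0

/-- The limit density `Ψ(r,w) = (1/η̄₁) 𝟙(r < η₋₁(w))`. -/
def limitDensity (Γ : Subgroup SL(2, ℝ)) (r : ℝ) (w : ℝ × ℝ) : ℝ :=
  1 / (meanReturnTime Γ).toReal * ind (ENNReal.ofReal r < backReturnTime Γ w)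

/-- The set `𝒫_Γ g = (0,1) Γ g` of row vectors. -/
def pointSet (Γ : Subgroup SL(2, ℝ)) (g : SL(2, ℝ)) : Set (Fin 2 → ℝ) :=
  {u | ∃ γ ∈ Γ, u = Matrix.vecMul ![0, 1] (γ * g : SL(2, ℝ)).val}

/-- The triangle `Δ_{-X} = {u : -X u₂ ≤ u₁ < 0, 0 < u₂ ≤ 1}`. -/
def negTriangle (X : ℝ) : Set (Fin 2 → ℝ) :=
  {u | -X * u 1 ≤ u 0 ∧ u 0 < 0 ∧ 0 < u 1 ∧ u 1 ≤ 1}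

/-- The group of Möbius transformations of `ℍ` induced by `Γ` (that is, the image of `Γ` in
`PSL(2,ℝ)`; the element `-1` acts trivially). -/
def moebiusGroup (Γ : Subgroup SL(2, ℝ)) : Subgroup (Equiv.Perm UpperHalfPlane) :=
  Γ.map (MulAction.toPermHom SL(2, ℝ) UpperHalfPlane)

end

end Horocycle

/-! Write $(c,d)$ for a bottom row. The section consists of the cosets with a representative whose
bottom row is $(0,d)$, $0<d\le1$, and $h^+_r$ replaces $(c,d)$ by $(c-rd,d)$. So the orbit of
$\Gamma g$ meets the section exactly at the slopes $r=c/d$ of the vectors $(c,d)\in\mathcal P_\Gamma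
g$ with $0<d\le1$ (`mem_hitTimes`). Discreteness makes these times locally finite
(`finite_hitTimes_inter`), so return times compare strictly and the triangle formula follows
(`lt_backReturnTime_iff`).

The mean return time is a Haar volume computed with two fundamental domains for $\Gamma$ acting on
the left of $\mathrm{SL}(2,\mathbb R)$. In the coordinates
$g=n(s)a(t)\begin{pmatrix}1&0\\-r&1\end{pmatrix}$ Haar measure is $e^{-t}\,ds\,dt\,dr$ on $d>0$. The
suspension $\{(s,t)\in\Sigma,\ 0\le r<\eta_1(s,t)\}$ has volume $\overline\eta_1$
(`haarSL_suspension`). The lift of $\mathcal F_\Gamma$ to $d>0$ has volume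
$\pi\operatorname{vol}_{\mathbb H}(\mathcal F_\Gamma)$, the $\pi$ being the integral of a Poisson
kernel (`setLIntegral_haarSL_smul_I`).

Uniqueness of representatives in the suspension comes from the last hit time $\le0$ and the
width-one cusp (`eq_one_of_mul_mem_suspension`). Covering requires almost every orbit to meet the
section in nonpositive time (`haarSL_avoidSet`). This uses finite volume and a monotonicity argument
in place of ergodicity: flowing by $h^+_n$ and $\varphi_{2n}$ shrinks the exceptional set while
preserving its volume modulo $\Gamma$. -/

namespace Horocycle

/-! ### Bottom rows, hit times and the triangle formula. -/

section Algebra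

variable {Γ : Subgroup SL(2, ℝ)}

@[simp] lemma aMat_apply (t : ℝ) :
    (aMat t).val = !![Real.exp (t / 2), 0; 0, Real.exp (-t / 2)] := rfl

@[simp] lemma nMat_apply (s : ℝ) : (nMat s).val = !![1, s; 0, 1] := rfl

@[simp] lemma lowMat_apply (r : ℝ) : (lowMat r).val = !![1, 0; r, 1] := rfl

lemma nMat_add (s s' : ℝ) : nMat (s + s') = nMat s * nMat s' := by
  ext i j
  fin_cases i <;> fin_cases j <;> simp [Matrix.mul_apply, Fin.sum_univ_two, add_comm]

lemma lowMat_add (r r' : ℝ) : lowMat (r + r') = lowMat r * lowMat r' := by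
  ext i j
  fin_cases i <;> fin_cases j <;> simp [Matrix.mul_apply, Fin.sum_univ_two]

lemma nMat_zero : nMat 0 = 1 := by
  ext i j
  fin_cases i <;> fin_cases j <;> simp

lemma lowMat_zero : lowMat 0 = 1 := by
  ext i j
  fin_cases i <;> fin_cases j <;> simp

lemma nMat_mul_aMat_val (s t : ℝ) : (nMat s * aMat t).val =
    !![Real.exp (t / 2), s * Real.exp (-t / 2); 0, Real.exp (-t / 2)] := by
  ext i j
  fin_cases i <;> fin_cases j <;> simp [Matrix.mul_apply, Fin.sum_univ_two]

lemma mul_lowMat_apply_one_zero (g : SL(2, ℝ)) (r : ℝ) :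
    (g * lowMat r) 1 0 = g 1 0 + r * g 1 1 := by
  simp [Matrix.mul_apply, Fin.sum_univ_two, mul_comm]

lemma mul_lowMat_apply_one_one (g : SL(2, ℝ)) (r : ℝ) : (g * lowMat r) 1 1 = g 1 1 := by
  simp [Matrix.mul_apply, Fin.sum_univ_two]

lemma mul_aMat_apply_one_zero (g : SL(2, ℝ)) (t : ℝ) :
    (g * aMat t) 1 0 = Real.exp (t / 2) * g 1 0 := by
  simp [Matrix.mul_apply, Fin.sum_univ_two, mul_comm]

lemma mul_aMat_apply_one_one (g : SL(2, ℝ)) (t : ℝ) :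
    (g * aMat t) 1 1 = Real.exp (-t / 2) * g 1 1 := by
  simp [Matrix.mul_apply, Fin.sum_univ_two, mul_comm]

lemma sl_det (g : SL(2, ℝ)) : g 0 0 * g 1 1 - g 0 1 * g 1 0 = 1 := by
  rw [← Matrix.det_fin_two]
  exact g.2

lemma toX_eq_iff {g h : SL(2, ℝ)} : toX Γ g = toX Γ h ↔ ∃ γ ∈ Γ, h = γ * g := by
  refine (Quotient.eq (r := QuotientGroup.rightRel Γ)).trans ?_
  rw [QuotientGroup.rightRel_apply]
  constructor
  · intro H
    exact ⟨_, H, by group⟩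
  · rintro ⟨γ, hγ, rfl⟩
    simpa using hγ

lemma embed_zero (s t : ℝ) : embed Γ 0 (s, t) = toX Γ (nMat s * aMat t) := by
  change toX Γ (1 * nMat s * aMat (t + 0)) = _
  rw [one_mul, add_zero]

lemma unstableFlow_toX (r : ℝ) (g : SL(2, ℝ)) :
    unstableFlow Γ r (toX Γ g) = toX Γ (g * lowMat (-r)) := rfl

lemma mem_section_iff_exists {g : SL(2, ℝ)} :
    toX Γ g ∈ section' Γ 0 ↔ ∃ t : ℝ, 0 ≤ t ∧ ∃ s : ℝ, ∃ γ ∈ Γ, γ * g = nMat s * aMat t := by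
  constructor
  · rintro ⟨t, ht, _, ⟨s, rfl⟩, h⟩
    change toX Γ g = toX Γ (1 * nMat s * aMat t) at h
    rw [one_mul, toX_eq_iff] at h
    obtain ⟨γ, hγ, h⟩ := h
    exact ⟨t, ht, s, γ, hγ, h.symm⟩
  · rintro ⟨t, ht, s, γ, hγ, h⟩
    refine ⟨t, ht, _, ⟨s, rfl⟩, ?_⟩
    change toX Γ g = toX Γ (1 * nMat s * aMat t)
    rw [one_mul, toX_eq_iff]
    exact ⟨γ, hγ, h.symm⟩

/-- The coordinate `s` in `g = n(s) a(t) (1 0; -r 1)`. -/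
noncomputable def coordS (g : SL(2, ℝ)) : ℝ := g 0 1 / g 1 1

/-- The coordinate `t` in `g = n(s) a(t) (1 0; -r 1)`. -/
noncomputable def coordT (g : SL(2, ℝ)) : ℝ := -2 * Real.log (g 1 1)

/-- The coordinate `r` in `g = n(s) a(t) (1 0; -r 1)`. -/
noncomputable def coordR (g : SL(2, ℝ)) : ℝ := -(g 1 0) / g 1 1

lemma nMat_mul_aMat_mul_lowMat_coord {g : SL(2, ℝ)} (hg : 0 < g 1 1) :
    nMat (coordS g) * aMat (coordT g) * lowMat (-coordR g) = g := by
  have h1 : Real.exp (-coordT g / 2) = g 1 1 := by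
    rw [coordT, show -(-2 * Real.log (g 1 1)) / 2 = Real.log (g 1 1) by ring, Real.exp_log hg]
  have h2 : Real.exp (coordT g / 2) = (g 1 1)⁻¹ := by
    rw [← h1, ← Real.exp_neg]
    congr 1
    ring
  have hd := sl_det g
  ext i j
  rw [Matrix.SpecialLinearGroup.coe_mul, nMat_mul_aMat_val, h1, h2, lowMat_apply]
  fin_cases i <;> fin_cases j <;> simp [Matrix.mul_apply, Fin.sum_univ_two, coordS, coordR] <;>
    field_simp
  linarith

/-- The products $n(s)a(t)$ are exactly the matrices with bottom row $(0,d)$, $d=e^{-t/2}>0$, and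
$t\ge0$ means $d\le1$. -/
lemma mem_section_iff {g : SL(2, ℝ)} : toX Γ g ∈ section' Γ 0 ↔
    ∃ γ ∈ Γ, (γ * g) 1 0 = 0 ∧ 0 < (γ * g) 1 1 ∧ (γ * g) 1 1 ≤ 1 := by
  rw [mem_section_iff_exists]
  constructor
  · rintro ⟨t, ht, s, γ, hγ, h⟩
    refine ⟨γ, hγ, ?_⟩
    have : (γ * g).val = _ := (congrArg Subtype.val h).trans (nMat_mul_aMat_val s t)
    rw [this]
    refine ⟨by simp, by simp [Real.exp_pos], ?_⟩
    simp
    linarith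
  · rintro ⟨γ, hγ, h0, hpos, hle⟩
    refine ⟨coordT (γ * g), ?_, coordS (γ * g), γ, hγ, ?_⟩
    · have := Real.log_nonpos hpos.le hle
      rw [coordT]
      linarith
    · have h := nMat_mul_aMat_mul_lowMat_coord hpos
      have hr : coordR (γ * g) = 0 := by
        rw [coordR, h0]
        simp
      rw [hr, neg_zero, lowMat_zero, mul_one] at h
      exact h.symm

/-- The times at which the unstable horocycle orbit of `Γ g` meets the section. -/
def hitTimes (Γ : Subgroup SL(2, ℝ)) (g : SL(2, ℝ)) : Set ℝ :=
  {r | toX Γ (g * lowMat (-r)) ∈ section' Γ 0}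

lemma mem_hitTimes {g : SL(2, ℝ)} {r : ℝ} : r ∈ hitTimes Γ g ↔
    ∃ γ ∈ Γ, (γ * g) 1 0 = r * (γ * g) 1 1 ∧ 0 < (γ * g) 1 1 ∧ (γ * g) 1 1 ≤ 1 := by
  rw [hitTimes, Set.mem_ofPred_eq, mem_section_iff]
  simp only [← mul_assoc, mul_lowMat_apply_one_zero, mul_lowMat_apply_one_one]
  refine exists_congr fun γ => and_congr_right fun _ => and_congr_left fun _ => ?_
  constructor <;> intro h <;> linarith

lemma mem_hitTimes_mul_lowMat {g : SL(2, ℝ)} {r r' : ℝ} :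
    r ∈ hitTimes Γ (g * lowMat (-r')) ↔ r' + r ∈ hitTimes Γ g := by
  rw [hitTimes, hitTimes, Set.mem_ofPred_eq, Set.mem_ofPred_eq, mul_assoc, ← lowMat_add, neg_add]

lemma hitTimes_smul {γ : SL(2, ℝ)} (hγ : γ ∈ Γ) (g : SL(2, ℝ)) :
    hitTimes Γ (γ * g) = hitTimes Γ g := by
  ext r
  rw [hitTimes, hitTimes, Set.mem_ofPred_eq, Set.mem_ofPred_eq, mul_assoc,
    (toX_eq_iff (g := g * lowMat (-r)) (h := γ * (g * lowMat (-r)))).2 ⟨γ, hγ, rfl⟩]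

lemma isCompact_bounded (C : ℝ) : IsCompact {k : SL(2, ℝ) | ∀ i j, |k i j| ≤ C} := by
  have hcl : Topology.IsClosedEmbedding (Subtype.val : SL(2, ℝ) → Matrix (Fin 2) (Fin 2) ℝ) := by
    refine Topology.IsClosedEmbedding.subtypeVal ?_
    exact isClosed_eq (Continuous.matrix_det continuous_id) continuous_const
  have hK : IsCompact (Set.pi Set.univ fun _ : Fin 2 => Set.pi Set.univ fun _ : Fin 2 =>
      Set.Icc (-C) C) := isCompact_univ_pi fun _ => isCompact_univ_pi fun _ => isCompact_Icc
  have he : {k : SL(2, ℝ) | ∀ i j, |k i j| ≤ C} = Subtype.val ⁻¹'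
      (Set.pi Set.univ fun _ : Fin 2 => Set.pi Set.univ fun _ : Fin 2 => Set.Icc (-C) C) := by
    ext k
    exact ⟨fun h i _ j _ => abs_le.1 (h i j), fun h i j => abs_le.2 (h i trivial j trivial)⟩
  rw [he]
  exact hcl.isCompact_preimage hK

lemma finite_conj_inter_bounded [DiscreteTopology Γ] (g : SL(2, ℝ)) (C : ℝ) :
    {k : SL(2, ℝ) | g * k * g⁻¹ ∈ Γ ∧ ∀ i j, |k i j| ≤ C}.Finite := by
  have hc : Continuous fun k : SL(2, ℝ) => g * k * g⁻¹ := by fun_prop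
  have hK := (isCompact_bounded C).image hc
  have hcl : IsClosed (Γ : Set SL(2, ℝ)) := Subgroup.isClosed_of_discrete
  have hfin : ((fun k : SL(2, ℝ) => g * k * g⁻¹) '' {k | ∀ i j, |k i j| ≤ C} ∩ Γ).Finite := by
    refine (hK.inter_right hcl).finite ?_
    exact IsDiscrete.mono (s := (Γ : Set SL(2, ℝ))) ⟨‹_›⟩ Set.inter_subset_right
  refine Set.Finite.of_finite_image (f := fun k => g * k * g⁻¹) (hfin.subset ?_) ?_
  · rintro _ ⟨k, ⟨h1, h2⟩, rfl⟩
    exact ⟨⟨k, h2, rfl⟩, h1⟩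
  · intro a _ b _ h
    simpa using h

lemma inv_mul_nMat_one_mul_val (h : SL(2, ℝ)) : (h⁻¹ * nMat 1 * h).val =
    !![1 + h 1 0 * h 1 1, h 1 1 ^ 2; -h 1 0 ^ 2, 1 - h 1 0 * h 1 1] := by
  have hd := sl_det h
  ext i j
  rw [Matrix.SpecialLinearGroup.coe_mul, Matrix.SpecialLinearGroup.coe_mul,
    Matrix.SpecialLinearGroup.coe_inv, Matrix.adjugate_fin_two]
  fin_cases i <;> fin_cases j <;> simp [Matrix.mul_apply, Fin.sum_univ_two] <;>
    first | linear_combination hd | linear_combination -hd | ring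

/-- For $h=\gamma g$ the conjugate $h^{-1}n(1)h\in g^{-1}\Gamma g$ depends only on the bottom row of
$h$. It is bounded when $|c/d|\le R$ and $0<d\le1$, so discreteness leaves finitely many conjugates,
and each determines $c/d$. -/
lemma finite_hitTimes_inter [DiscreteTopology Γ] (h1 : nMat 1 ∈ Γ) (g : SL(2, ℝ)) (R : ℝ) :
    (hitTimes Γ g ∩ Set.Icc (-R) R).Finite := by
  -- The conjugate has entries $1\pm cd$, $d^2$, $-c^2$ with $|c|\le R$, $d\le1$, whence the bound.
  -- The slope is recovered as $cd/d^2$.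
  refine ((finite_conj_inter_bounded (Γ := Γ) g (1 + R + R ^ 2)).image
    fun k => (k 0 0 - 1) / k 0 1).subset ?_
  rintro r ⟨hr, hrR⟩
  obtain ⟨γ, hγ, h10, hpos, hle⟩ := mem_hitTimes.1 hr
  set h := γ * g with hh
  refine ⟨h⁻¹ * nMat 1 * h, ⟨?_, ?_⟩, ?_⟩
  · rw [hh, show g * ((γ * g)⁻¹ * nMat 1 * (γ * g)) * g⁻¹ = γ⁻¹ * nMat 1 * γ by group]
    exact Γ.mul_mem (Γ.mul_mem (Γ.inv_mem hγ) h1) hγ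
  · have hR : |r| ≤ R := abs_le.2 hrR
    have hR0 : 0 ≤ R := (abs_nonneg r).trans hR
    have hc : |h 1 0| ≤ R := by
      rw [h10, abs_mul, abs_of_pos hpos]
      nlinarith [abs_nonneg r]
    have hd : |h 1 1| ≤ 1 := by rwa [abs_of_pos hpos]
    have hcd : |h 1 0 * h 1 1| ≤ R := by
      rw [abs_mul]
      nlinarith [abs_nonneg (h 1 0), abs_nonneg (h 1 1)]
    have hc2 : h 1 0 ^ 2 ≤ R ^ 2 := sq_le_sq' (abs_le.1 hc).1 (abs_le.1 hc).2
    have hd2 : h 1 1 ^ 2 ≤ 1 := by nlinarith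
    have := abs_le.1 hcd
    intro i j
    rw [inv_mul_nMat_one_mul_val]
    rw [abs_le]
    fin_cases i <;> fin_cases j <;> simp <;> constructor <;> nlinarith
  · change ((h⁻¹ * nMat 1 * h).val 0 0 - 1) / (h⁻¹ * nMat 1 * h).val 0 1 = r
    rw [inv_mul_nMat_one_mul_val]
    simp
    rw [h10]
    field_simp

lemma ofReal_lt_sInf_iff {S : Set ℝ} (hS : ∀ R, (S ∩ Set.Icc (-R) R).Finite) {r : ℝ}
    (hr : 0 ≤ r) : ENNReal.ofReal r < sInf {a | ∃ r', 0 < r' ∧ r' ∈ S ∧ a = ENNReal.ofReal r'} ↔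
      ∀ r' ∈ S, 0 < r' → r < r' := by
  constructor
  · intro h r' hr' hpos
    have := h.trans_le (sInf_le ⟨r', hpos, hr', rfl⟩)
    exact (ENNReal.ofReal_lt_ofReal_iff hpos).1 this
  · intro h
    obtain ⟨b, hb, hbS⟩ : ∃ b, r < b ∧ ∀ r' ∈ S, 0 < r' → b ≤ r' := by
      -- Adjoining $r+1$ keeps the set nonempty even if no hit occurs, and bounds all hits beyond
      -- the window.
      have hf : (S ∩ Set.Icc (-(r + 1)) (r + 1) ∩ Set.Ioi 0 ∪ {r + 1}).Finite :=
        ((hS (r + 1)).inter_of_left _).union (Set.finite_singleton _)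
      obtain ⟨b, hb, hmin⟩ := Set.exists_min_image _ id hf ⟨r + 1, Or.inr rfl⟩
      refine ⟨b, ?_, fun r' hr' hpos => ?_⟩
      · rcases hb with hb | hb
        · exact h b hb.1.1 hb.2
        · rw [Set.mem_singleton_iff.1 hb]
          linarith
      · rcases le_total r' (r + 1) with hle | hle
        · exact hmin r' (Or.inl ⟨⟨hr', by linarith, hle⟩, hpos⟩)
        · exact (hmin (r + 1) (Or.inr rfl)).trans hle
    refine lt_of_lt_of_le ((ENNReal.ofReal_lt_ofReal_iff (hr.trans_lt hb)).2 hb) (le_sInf ?_)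
    rintro _ ⟨r', hpos, hr', rfl⟩
    exact ENNReal.ofReal_le_ofReal (hbS r' hr' hpos)

lemma returnTime_eq (s t : ℝ) : returnTime Γ (s, t) =
    sInf {a | ∃ r, 0 < r ∧ r ∈ hitTimes Γ (nMat s * aMat t) ∧ a = ENNReal.ofReal r} := by
  simp only [returnTime, embed_zero, unstableFlow_toX, hitTimes, Set.mem_ofPred_eq]

lemma backReturnTime_eq (s t : ℝ) : backReturnTime Γ (s, t) =
    sInf {a | ∃ r, 0 < r ∧ r ∈ Neg.neg ⁻¹' hitTimes Γ (nMat s * aMat t) ∧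
      a = ENNReal.ofReal r} := by
  simp only [backReturnTime, embed_zero, unstableFlow_toX, hitTimes, Set.mem_ofPred_eq,
    Set.mem_preimage]

lemma lt_returnTime_iff [DiscreteTopology Γ] (h1 : nMat 1 ∈ Γ) {r s t : ℝ} (hr : 0 ≤ r) :
    ENNReal.ofReal r < returnTime Γ (s, t) ↔
      ∀ r' ∈ hitTimes Γ (nMat s * aMat t), 0 < r' → r < r' := by
  rw [returnTime_eq, ofReal_lt_sInf_iff (finite_hitTimes_inter h1 _) hr]

lemma lt_backReturnTime_iff [DiscreteTopology Γ] (h1 : nMat 1 ∈ Γ) {r s t : ℝ} (hr : 0 < r) :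
    ENNReal.ofReal r < backReturnTime Γ (s, t) ↔
      pointSet Γ (nMat s * aMat t) ∩ negTriangle r = ∅ := by
  rw [backReturnTime_eq, ofReal_lt_sInf_iff (fun R => ?_) hr.le]
  · rw [Set.eq_empty_iff_forall_notMem]
    have hrow : ∀ (g : SL(2, ℝ)) (j : Fin 2), Matrix.vecMul ![0, 1] g.val j = g 1 j := by
      intro g j
      simp [Matrix.vecMul, dotProduct, Fin.sum_univ_two]
    constructor
    · rintro h u ⟨⟨γ, hγ, rfl⟩, hu1, hu2, hu3, hu4⟩
      rw [hrow] at hu1 hu2 hu3 hu4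
      rw [hrow] at hu1
      set k := γ * (nMat s * aMat t)
      have := h (-(k 1 0 / k 1 1)) (by
        rw [Set.mem_preimage, neg_neg, mem_hitTimes]
        exact ⟨γ, hγ, by change k 1 0 = k 1 0 / k 1 1 * k 1 1; field_simp, hu3, hu4⟩)
        (by rw [neg_pos]; exact div_neg_of_neg_of_pos hu2 hu3)
      rw [lt_neg, div_lt_iff₀ hu3] at this
      linarith
    · intro h r' hr' hpos
      rw [Set.mem_preimage, mem_hitTimes] at hr'
      obtain ⟨γ, hγ, h10, h11, hle⟩ := hr'
      by_contra hlt
      refine h _ ⟨⟨γ, hγ, rfl⟩, ?_⟩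
      change _ ≤ _ ∧ _ ∧ _ ∧ _
      rw [hrow, hrow]
      refine ⟨?_, ?_, h11, hle⟩
      · rw [h10]
        nlinarith
      · rw [h10]
        nlinarith
  · have := (finite_hitTimes_inter h1 (nMat s * aMat t) R).preimage neg_injective.injOn
    refine this.subset ?_
    rintro x ⟨hx1, hx2, hx3⟩
    exact ⟨hx1, by linarith, by linarith⟩

end Algebra

/-! ### Haar measure on $\mathrm{SL}(2,\mathbb R)$ in explicit coordinates. -/

section Haar

instance : MeasurableSpace SL(2, ℝ) :=
  MeasurableSpace.comap (fun g i j => g i j : SL(2, ℝ) → Fin 2 → Fin 2 → ℝ) inferInstance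

@[fun_prop]
lemma measurable_entry (i j : Fin 2) : Measurable fun g : SL(2, ℝ) => g i j :=
  (measurable_pi_apply j).comp ((measurable_pi_apply i).comp (comap_measurable _))

lemma measurable_sl_iff {α : Type*} [MeasurableSpace α] {f : α → SL(2, ℝ)} :
    Measurable f ↔ ∀ i j, Measurable fun x => f x i j := by
  rw [measurable_comap_iff, measurable_pi_iff]
  simp only [measurable_pi_iff]
  rfl

lemma measurable_sl_mul {α : Type*} [MeasurableSpace α] {f g : α → SL(2, ℝ)} (hf : Measurable f)
    (hg : Measurable g) : Measurable fun x => f x * g x := by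
  rw [measurable_sl_iff] at *
  intro i j
  simp only [Matrix.SpecialLinearGroup.coe_mul, Matrix.mul_apply]
  exact Finset.measurable_sum _ fun k _ => (hf i k).mul (hg k j)

lemma measurable_nMat : Measurable nMat := by
  rw [measurable_sl_iff]
  intro i j
  fin_cases i <;> fin_cases j <;> (simp; try fun_prop)

lemma measurable_aMat : Measurable aMat := by
  rw [measurable_sl_iff]
  intro i j
  fin_cases i <;> fin_cases j <;> (simp; try fun_prop)

lemma measurable_lowMat : Measurable lowMat := by
  rw [measurable_sl_iff]
  intro i j
  fin_cases i <;> fin_cases j <;> (simp; try fun_prop)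

/-- The element of `SL(2, ℝ)` with second column `(b, d)` and second row `(-r d, d)`, if
`d ≠ 0`. -/
noncomputable def colChart (p : (ℝ × ℝ) × ℝ) : SL(2, ℝ) :=
  ⟨!![1 / (if p.1.2 = 0 then 1 else p.1.2) - p.2 * p.1.1, p.1.1;
      -p.2 * (if p.1.2 = 0 then 1 else p.1.2), if p.1.2 = 0 then 1 else p.1.2], by
    rw [Matrix.det_fin_two_of]
    have : (if p.1.2 = 0 then 1 else p.1.2) ≠ 0 := by
      split_ifs with h <;> simp [h]
    field_simp
    ring⟩

/-- The substitute value $1$ for $d=0$ only makes the chart total; it affects a null set. -/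
lemma colChart_val {p : (ℝ × ℝ) × ℝ} (hp : p.1.2 ≠ 0) :
    (colChart p).val = !![1 / p.1.2 - p.2 * p.1.1, p.1.1; -p.2 * p.1.2, p.1.2] := by
  simp [colChart, hp]

lemma measurable_colChart : Measurable colChart := by
  have h : Measurable fun p : (ℝ × ℝ) × ℝ => if p.1.2 = 0 then (1 : ℝ) else p.1.2 :=
    Measurable.ite (measurableSet_eq_fun (by fun_prop) (by fun_prop)) (by fun_prop) (by fun_prop)
  rw [measurable_sl_iff]
  intro i j
  fin_cases i <;> fin_cases j
  · exact (measurable_const.div h).sub (by fun_prop)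
  · exact measurable_fst.fst
  · exact measurable_snd.neg.mul h
  · exact h

/-- A Haar measure on `SL(2, ℝ)`, in coordinates `g = n(s) a(t) (1 0; -r 1)` equal to
`e^{-t} ds dt dr`. -/
noncomputable def haarSL : Measure SL(2, ℝ) := (2 : ℝ≥0∞) • Measure.map colChart volume

lemma lintegral_haarSL {f : SL(2, ℝ) → ℝ≥0∞} (hf : Measurable f) :
    ∫⁻ g, f g ∂haarSL = 2 * ∫⁻ p, f (colChart p) := by
  rw [haarSL, lintegral_smul_measure, lintegral_map hf measurable_colChart, smul_eq_mul]

lemma ae_snd_ne_zero : ∀ᵐ v : ℝ × ℝ, v.2 ≠ 0 :=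
  (Measure.quasiMeasurePreserving_snd (μ := (volume : Measure ℝ)) (ν := (volume : Measure ℝ))).ae
    (Measure.ae_ne volume 0)

lemma measurePreserving_haarSL_of_chart {f : SL(2, ℝ) → SL(2, ℝ)} (hf : Measurable f)
    {T : (ℝ × ℝ) × ℝ → (ℝ × ℝ) × ℝ} (hT : MeasurePreserving T)
    (h : ∀ᵐ p, f (colChart p) = colChart (T p)) : MeasurePreserving f haarSL haarSL := by
  refine ⟨hf, ?_⟩
  rw [haarSL, Measure.map_smul, Measure.map_map hf measurable_colChart]
  congr 1
  rw [Measure.map_congr (f := f ∘ colChart) (g := colChart ∘ T) h,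
    ← Measure.map_map measurable_colChart hT.measurable, hT.map_eq]

lemma measurePreserving_sl_col (h : SL(2, ℝ)) : MeasurePreserving
    (fun v : ℝ × ℝ => (h 0 0 * v.1 + h 0 1 * v.2, h 1 0 * v.1 + h 1 1 * v.2)) := by
  have hdet : LinearMap.det (Matrix.toLin (Module.Basis.finTwoProd ℝ) (Module.Basis.finTwoProd ℝ)
      h.val) = 1 := by
    rw [LinearMap.det_toLin]
    exact h.2
  have := Measure.map_linearMap_addHaar_eq_smul_addHaar (volume : Measure (ℝ × ℝ))
    (f := Matrix.toLin (Module.Basis.finTwoProd ℝ) (Module.Basis.finTwoProd ℝ) h.val)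
    (by rw [hdet]; exact one_ne_zero)
  rw [hdet] at this
  refine ⟨by fun_prop, ?_⟩
  convert this using 1
  · congr 1
    ext v
    · simp [Matrix.toLin_apply, Matrix.mulVec, dotProduct, Fin.sum_univ_two]
    · simp [Matrix.toLin_apply, Matrix.mulVec, dotProduct, Fin.sum_univ_two]
  · simp

/-- Left multiplication acts on the second column by a linear map of determinant one and translates
$r$ by an amount depending only on that column, so it is a skew product of measure-preserving maps.
-/
lemma measurePreserving_mul_left (h : SL(2, ℝ)) :
    MeasurePreserving (fun g => h * g) haarSL haarSL := by
  have hcol := measurePreserving_sl_col h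
  have hT : MeasurePreserving (fun p : (ℝ × ℝ) × ℝ =>
      (((h 0 0 * p.1.1 + h 0 1 * p.1.2, h 1 0 * p.1.1 + h 1 1 * p.1.2),
        -(h 1 0 / (p.1.2 * (h 1 0 * p.1.1 + h 1 1 * p.1.2))) + p.2) : (ℝ × ℝ) × ℝ)) := by
    refine MeasurePreserving.skew_product (g := fun (v : ℝ × ℝ) (r : ℝ) =>
      -(h 1 0 / (v.2 * (h 1 0 * v.1 + h 1 1 * v.2))) + r) hcol ?_ ?_
    · unfold Function.uncurry
      fun_prop
    · exact Filter.Eventually.of_forall fun v => map_add_left_eq_self _ _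
  refine measurePreserving_haarSL_of_chart (measurable_sl_mul measurable_const measurable_id) hT ?_
  have hd : ∀ᵐ p : (ℝ × ℝ) × ℝ, p.1.2 ≠ 0 :=
    (Measure.quasiMeasurePreserving_fst (μ := (volume : Measure (ℝ × ℝ)))
      (ν := (volume : Measure ℝ))).ae ae_snd_ne_zero
  have hd' : ∀ᵐ p : (ℝ × ℝ) × ℝ, h 1 0 * p.1.1 + h 1 1 * p.1.2 ≠ 0 :=
    (Measure.quasiMeasurePreserving_fst (μ := (volume : Measure (ℝ × ℝ)))
      (ν := (volume : Measure ℝ))).ae (hcol.quasiMeasurePreserving.ae ae_snd_ne_zero)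
  filter_upwards [hd, hd'] with p hp hp'
  obtain ⟨⟨b, d⟩, r⟩ := p
  have hdet := sl_det h
  dsimp only at hp hp' ⊢
  generalize hD : h 1 0 * b + h 1 1 * d = D at hp' ⊢
  apply Subtype.ext
  rw [Matrix.SpecialLinearGroup.coe_mul, colChart_val (p := ((b, d), r)) hp,
    colChart_val (p := ((_, D), _)) hp', Matrix.eta_fin_two h.val, Matrix.mul_fin_two]
  ext i j
  fin_cases i <;> fin_cases j <;> simp <;> field_simp
  · linear_combination d * hdet - h 0 0 * hD
  · linear_combination -(r * d) * hD
  · exact hD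

lemma measurePreserving_mul_lowMat (τ : ℝ) :
    MeasurePreserving (fun g => g * lowMat τ) haarSL haarSL := by
  have hT : MeasurePreserving (fun p : (ℝ × ℝ) × ℝ => (p.1, -τ + p.2)) :=
    MeasurePreserving.skew_product (g := fun (_ : ℝ × ℝ) (r : ℝ) => -τ + r)
      (MeasurePreserving.id _) (by unfold Function.uncurry; fun_prop)
      (Filter.Eventually.of_forall fun v => map_add_left_eq_self _ _)
  refine measurePreserving_haarSL_of_chart (measurable_sl_mul measurable_id measurable_const) hT ?_
  filter_upwards [(Measure.quasiMeasurePreserving_fst (μ := (volume : Measure (ℝ × ℝ)))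
      (ν := (volume : Measure ℝ))).ae ae_snd_ne_zero] with p hp
  apply Subtype.ext
  rw [Matrix.SpecialLinearGroup.coe_mul, colChart_val hp, colChart_val (by exact hp),
    lowMat_apply, Matrix.mul_fin_two]
  ext i j
  fin_cases i <;> fin_cases j <;> simp <;> ring

/-- The column is scaled by $e^{-t/2}$, an area factor $e^{-t}$, which cancels the factor $e^t$ by
which $r$ is scaled. -/
lemma measurePreserving_mul_aMat (t : ℝ) :
    MeasurePreserving (fun g => g * aMat t) haarSL haarSL := by
  have he : Real.exp t ≠ 0 := (Real.exp_pos _).ne'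
  have hT : MeasurePreserving (fun p : (ℝ × ℝ) × ℝ =>
      (Real.exp (-t / 2) • p.1, Real.exp t * p.2)) := by
    refine ⟨by fun_prop, ?_⟩
    have h1 := Measure.map_addHaar_smul (volume : Measure (ℝ × ℝ)) (Real.exp_pos (-t / 2)).ne'
    have h2 := Real.map_volume_mul_left he
    have h3 : (Real.exp (-t / 2) ^ 2)⁻¹ = Real.exp t := by
      rw [← Real.exp_nat_mul, ← Real.exp_neg]
      congr 1
      push_cast
      ring
    rw [Module.finrank_prod, Module.finrank_self, h3, abs_of_pos (Real.exp_pos t)] at h1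
    rw [abs_of_pos (by positivity)] at h2
    change Measure.map (Prod.map (fun v : ℝ × ℝ => Real.exp (-t / 2) • v) (fun r => Real.exp t * r))
      ((volume : Measure (ℝ × ℝ)).prod (volume : Measure ℝ)) = _
    rw [← Measure.map_prod_map _ _ (by fun_prop) (by fun_prop), h1, h2, Measure.prod_smul_left,
      Measure.prod_smul_right, smul_smul, ← ENNReal.ofReal_mul (Real.exp_pos t).le,
      mul_inv_cancel₀ he, ENNReal.ofReal_one, one_smul]
    rfl
  refine measurePreserving_haarSL_of_chart (measurable_sl_mul measurable_id measurable_const) hT ?_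
  filter_upwards [(Measure.quasiMeasurePreserving_fst (μ := (volume : Measure (ℝ × ℝ)))
      (ν := (volume : Measure ℝ))).ae ae_snd_ne_zero] with p hp
  have h1 : Real.exp t = Real.exp (t / 2) * Real.exp (t / 2) := by
    rw [← Real.exp_add]
    ring_nf
  have h2 : Real.exp (-t / 2) = (Real.exp (t / 2))⁻¹ := by
    rw [← Real.exp_neg]
    ring_nf
  have h3 := Real.exp_pos (t / 2)
  apply Subtype.ext
  rw [Matrix.SpecialLinearGroup.coe_mul, colChart_val hp, colChart_val (by
    simpa using hp), aMat_apply, Matrix.mul_fin_two]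
  ext i j
  fin_cases i <;> fin_cases j <;> simp [h1, h2] <;> field_simp

/-- The element `n(s) a(t) (1 0; -r 1)`. -/
noncomputable def horoChart (s t r : ℝ) : SL(2, ℝ) := nMat s * aMat t * lowMat (-r)

@[fun_prop]
lemma Measurable.horoChart {α : Type*} [MeasurableSpace α] {s t r : α → ℝ} (hs : Measurable s)
    (ht : Measurable t) (hr : Measurable r) :
    Measurable fun x => Horocycle.horoChart (s x) (t x) (r x) :=
  measurable_sl_mul (measurable_sl_mul (measurable_nMat.comp hs) (measurable_aMat.comp ht))
    (measurable_lowMat.comp hr.neg)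

lemma colChart_eq_horoChart (s t r : ℝ) :
    colChart ((s * Real.exp (-t / 2), Real.exp (-t / 2)), r) = horoChart s t r := by
  apply Subtype.ext
  rw [colChart_val (Real.exp_pos _).ne', horoChart, Matrix.SpecialLinearGroup.coe_mul,
    nMat_mul_aMat_val, lowMat_apply, Matrix.mul_fin_two]
  have h2 : Real.exp (-t / 2) = (Real.exp (t / 2))⁻¹ := by
    rw [← Real.exp_neg]
    ring_nf
  ext i j
  fin_cases i <;> fin_cases j <;> simp [h2, mul_comm, sub_eq_add_neg]

lemma lintegral_Ioi_zero_eq_lintegral_exp (f : ℝ → ℝ≥0∞) {k : ℝ} (hk : 0 < k) :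
    ∫⁻ x in Set.Ioi 0, f x =
      ∫⁻ t, ENNReal.ofReal (Real.exp (-t / k) / k) * f (Real.exp (-t / k)) := by
  have himg : (fun t : ℝ => Real.exp (-t / k)) '' Set.univ = Set.Ioi 0 := by
    rw [Set.image_univ]
    ext x
    constructor
    · rintro ⟨t, rfl⟩
      exact Real.exp_pos _
    · intro hx
      refine ⟨-k * Real.log x, ?_⟩
      dsimp only
      rw [show -(-k * Real.log x) / k = Real.log x by field_simp, Real.exp_log hx]
  have hder : ∀ t ∈ Set.univ, HasDerivWithinAt (fun t : ℝ => Real.exp (-t / k))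
      (Real.exp (-t / k) * (-1 / k)) Set.univ t := fun t _ =>
    (((hasDerivAt_id t).neg.div_const k).exp).hasDerivWithinAt
  have hinj : Set.InjOn (fun t : ℝ => Real.exp (-t / k)) Set.univ := by
    intro a _ b _ hab
    have := Real.exp_injective hab
    field_simp at this
    linarith
  rw [← himg, lintegral_image_eq_lintegral_abs_deriv_mul MeasurableSet.univ hder hinj,
    Measure.restrict_univ]
  refine lintegral_congr fun t => ?_
  rw [abs_mul, abs_of_pos (Real.exp_pos _), abs_div, abs_neg, abs_one, abs_of_pos hk,
    mul_one_div]

lemma lintegral_eq_ofReal_mul_lintegral_comp_mul (f : ℝ → ℝ≥0∞) (hf : Measurable f) {c : ℝ}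
    (hc : 0 < c) :
    ∫⁻ x, f x = ENNReal.ofReal c * ∫⁻ s, f (s * c) := by
  have h := Real.smul_map_volume_mul_right hc.ne'
  conv_lhs => rw [← h]
  rw [lintegral_smul_measure, lintegral_map hf (by fun_prop), abs_of_pos hc, smul_eq_mul]

/-- Substitute $d=e^{-t/2}$ and $b=sd$ in the column coordinates. -/
lemma setLIntegral_haarSL {f : SL(2, ℝ) → ℝ≥0∞} (hf : Measurable f) :
    ∫⁻ g in {g | 0 < g 1 1}, f g ∂haarSL =
      ∫⁻ t, ENNReal.ofReal (Real.exp (-t)) * ∫⁻ s, ∫⁻ r, f (horoChart s t r) := by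
  have hS : MeasurableSet {g : SL(2, ℝ) | 0 < g 1 1} :=
    measurableSet_lt measurable_const (measurable_entry 1 1)
  have hind : ∀ p : (ℝ × ℝ) × ℝ, p.1.2 ≠ 0 →
      {g : SL(2, ℝ) | 0 < g 1 1}.indicator f (colChart p) =
        (Set.Ioi (0 : ℝ)).indicator (fun _ => f (colChart p)) p.1.2 := by
    intro p hp
    have : (colChart p) 1 1 = p.1.2 := by
      rw [colChart_val hp]
      rfl
    simp only [Set.indicator_apply, Set.mem_ofPred_eq, this, Set.mem_Ioi]
  have hmeas : Measurable fun q : (ℝ × ℝ) × ℝ => f (colChart q) := hf.comp measurable_colChart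
  have hmeas' : Measurable fun v : ℝ × ℝ => ∫⁻ r, f (colChart (v, r)) :=
    Measurable.lintegral_prod_right' hmeas
  rw [← lintegral_indicator hS, lintegral_haarSL (hf.indicator hS)]
  have h1 : ∫⁻ p, {g : SL(2, ℝ) | 0 < g 1 1}.indicator f (colChart p) =
      ∫⁻ p : (ℝ × ℝ) × ℝ, (Set.Ioi (0 : ℝ)).indicator (fun _ => f (colChart p)) p.1.2 := by
    refine lintegral_congr_ae ?_
    filter_upwards [(Measure.quasiMeasurePreserving_fst (μ := (volume : Measure (ℝ × ℝ)))
      (ν := (volume : Measure ℝ))).ae ae_snd_ne_zero] with p hp using hind p hp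
  have hm1 : Measurable fun p : (ℝ × ℝ) × ℝ =>
      (Set.Ioi (0 : ℝ)).indicator (fun _ => f (colChart p)) p.1.2 :=
    hmeas.indicator (s := {p : (ℝ × ℝ) × ℝ | 0 < p.1.2})
      (measurableSet_lt measurable_const (by fun_prop))
  have h2 : ∫⁻ p : (ℝ × ℝ) × ℝ, (Set.Ioi (0 : ℝ)).indicator (fun _ => f (colChart p)) p.1.2 =
      ∫⁻ v : ℝ × ℝ, (Set.Ioi (0 : ℝ)).indicator (fun _ => ∫⁻ r, f (colChart (v, r))) v.2 := by
    rw [Measure.volume_eq_prod, lintegral_prod _ hm1.aemeasurable]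
    refine lintegral_congr fun v => ?_
    by_cases hv : v.2 ∈ Set.Ioi (0 : ℝ)
    · simp only [Set.indicator_of_mem hv]
    · simp only [Set.indicator_of_notMem hv, lintegral_zero]
  have hm2 : Measurable fun v : ℝ × ℝ =>
      (Set.Ioi (0 : ℝ)).indicator (fun _ => ∫⁻ r, f (colChart (v, r))) v.2 :=
    hmeas'.indicator (s := {v : ℝ × ℝ | 0 < v.2})
      (measurableSet_lt measurable_const (by fun_prop))
  have h3 : ∫⁻ v : ℝ × ℝ, (Set.Ioi (0 : ℝ)).indicator (fun _ => ∫⁻ r, f (colChart (v, r))) v.2 =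
      ∫⁻ d in Set.Ioi (0 : ℝ), ∫⁻ b, ∫⁻ r, f (colChart ((b, d), r)) := by
    rw [Measure.volume_eq_prod, lintegral_prod_symm _ hm2.aemeasurable,
      ← lintegral_indicator measurableSet_Ioi]
    refine lintegral_congr fun d => ?_
    by_cases hd : d ∈ Set.Ioi (0 : ℝ)
    · simp only [Set.indicator_of_mem hd]
    · simp only [Set.indicator_of_notMem hd, lintegral_zero]
  rw [h1, h2, h3, lintegral_Ioi_zero_eq_lintegral_exp _ two_pos,
    ← lintegral_const_mul' _ _ (by simp)]
  refine lintegral_congr fun t => ?_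
  have hpos := Real.exp_pos (-t / 2)
  rw [lintegral_eq_ofReal_mul_lintegral_comp_mul (fun b => ∫⁻ r, f (colChart ((b, _), r)))
    (hmeas'.comp (by fun_prop)) hpos, ← mul_assoc, ← mul_assoc]
  congr 1
  -- The normalising factor $2$ of `haarSL` absorbs the $\tfrac12$ in the Jacobian
  -- $\tfrac12e^{-t/2}\cdot e^{-t/2}$.
  · rw [show (2 : ℝ≥0∞) = ENNReal.ofReal 2 by simp, ← ENNReal.ofReal_mul (by norm_num),
      ← ENNReal.ofReal_mul (by positivity)]
    have hsq : Real.exp (-t) = Real.exp (-t / 2) * Real.exp (-t / 2) := by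
      rw [← Real.exp_add, add_halves]
    rw [hsq]
    congr 1
    ring
  · simp only [colChart_eq_horoChart]

end Haar

/-! ### Projection of Haar measure to the hyperbolic plane. -/

section HalfPlane

/-- The point `e^{-t} (r + i)` of the upper half-plane. -/
noncomputable def halfPlaneChart (p : ℝ × ℝ) : UpperHalfPlane :=
  ⟨⟨Real.exp (-p.1) * p.2, Real.exp (-p.1)⟩, Real.exp_pos _⟩

lemma coe_halfPlaneChart (p : ℝ × ℝ) : (halfPlaneChart p : ℂ) =
    ⟨p.2 * Real.exp (-p.1), Real.exp (-p.1)⟩ := by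
  rw [mul_comm]
  rfl

lemma measurable_halfPlaneChart : Measurable halfPlaneChart := by
  rw [← UpperHalfPlane.measurableEmbedding_coe.measurable_comp_iff,
    ← Complex.measurableEquivRealProd.measurableEmbedding.measurable_comp_iff]
  change Measurable fun p : ℝ × ℝ => (Real.exp (-p.1) * p.2, Real.exp (-p.1))
  fun_prop

/-- With $x=re^{-t}$ and $y=e^{-t}$ the Jacobian is $e^{-2t}=y^2$, so $dx\,dy/y^2=dt\,dr$. -/
lemma map_halfPlaneChart : Measure.map halfPlaneChart volume = volume := by
  ext A hA
  have hA' : MeasurableSet ((↑) '' A : Set ℂ) :=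
    UpperHalfPlane.measurableEmbedding_coe.measurableSet_image.2 hA
  have hmem : ∀ p : ℝ × ℝ, (Complex.measurableEquivRealProd.symm p) ∈ ((↑) '' A : Set ℂ) →
      0 < p.2 := by
    rintro p ⟨z, -, hz⟩
    have : z.im = (Complex.measurableEquivRealProd.symm p).im := congrArg Complex.im hz
    have h2 : (Complex.measurableEquivRealProd.symm p).im = p.2 := rfl
    rw [← h2, ← this]
    exact z.im_pos
  set F : ℂ → ℝ≥0∞ := ((↑) '' A : Set ℂ).indicator fun z => ↑((1 / ‖z.im‖₊) ^ 2 : NNReal) with hF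
  have hFm : Measurable F := by
    refine Measurable.indicator ?_ hA'
    have : Measurable fun z : ℂ => ((1 / ‖z.im‖₊) ^ 2 : NNReal) :=
      ((measurable_const.div (Complex.measurable_im.nnnorm)).pow_const 2)
    exact this.coe_nnreal_ennreal
  have hFm' : Measurable fun p : ℝ × ℝ => F (Complex.measurableEquivRealProd.symm p) :=
    hFm.comp (MeasurableEquiv.measurable _)
  rw [UpperHalfPlane.volume_eq_lintegral, ← lintegral_indicator hA',
    ← (Complex.volume_preserving_equiv_real_prod.symm).lintegral_comp hFm,
    Measure.volume_eq_prod, lintegral_prod_symm _ hFm'.aemeasurable]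
  have h1 : ∫⁻ y : ℝ, ∫⁻ x : ℝ, F (Complex.measurableEquivRealProd.symm (x, y)) =
      ∫⁻ y in Set.Ioi (0 : ℝ), ∫⁻ x : ℝ, F (Complex.measurableEquivRealProd.symm (x, y)) := by
    rw [← lintegral_indicator measurableSet_Ioi]
    refine lintegral_congr fun y => ?_
    by_cases hy : y ∈ Set.Ioi (0 : ℝ)
    · rw [Set.indicator_of_mem hy]
    · rw [Set.indicator_of_notMem hy]
      refine (lintegral_congr fun x => ?_).trans lintegral_zero
      rw [hF, Set.indicator_of_notMem]
      exact fun h => hy (hmem (x, y) h)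
  rw [h1, lintegral_Ioi_zero_eq_lintegral_exp _ one_pos, Measure.map_apply
    measurable_halfPlaneChart hA, ← lintegral_indicator_one (measurable_halfPlaneChart hA),
    lintegral_prod _ (measurable_one.indicator (measurable_halfPlaneChart hA)).aemeasurable]
  refine lintegral_congr fun t => ?_
  have hpos := Real.exp_pos (-t)
  simp only [div_one]
  rw [lintegral_eq_ofReal_mul_lintegral_comp_mul
    (fun x => F (Complex.measurableEquivRealProd.symm (x, Real.exp (-t))))
    (hFm'.comp (by fun_prop)) hpos, ← mul_assoc, ← lintegral_const_mul' _ _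
      (by rw [← ENNReal.ofReal_mul hpos.le]; simp)]
  refine lintegral_congr fun r => ?_
  have hc : Complex.measurableEquivRealProd.symm (r * Real.exp (-t), Real.exp (-t)) =
      (halfPlaneChart (t, r) : ℂ) := (coe_halfPlaneChart (t, r)).symm
  rw [hc, hF]
  by_cases h : halfPlaneChart (t, r) ∈ A
  · rw [Set.indicator_of_mem (by exact h), Set.indicator_of_mem (Set.mem_image_of_mem _ h),
      coe_halfPlaneChart]
    simp only [Pi.one_apply]
    rw [← ENNReal.ofReal_mul hpos.le, ← ENNReal.ofReal_coe_nnreal,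
      ← ENNReal.ofReal_mul (by positivity)]
    simp only [NNReal.coe_pow, NNReal.coe_div, NNReal.coe_one, coe_nnnorm, Real.norm_eq_abs,
      abs_of_pos hpos]
    rw [← ENNReal.ofReal_one]
    congr 1
    field_simp
  · rw [Set.indicator_of_notMem (by exact h), Set.indicator_of_notMem, mul_zero]
    rintro ⟨z, hz, hzw⟩
    exact h (UpperHalfPlane.ext hzw ▸ hz)

lemma lintegral_halfPlane {K : UpperHalfPlane → ℝ≥0∞} (hK : Measurable K) :
    ∫⁻ z, K z = ∫⁻ t, ∫⁻ r, K (halfPlaneChart (t, r)) := by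
  rw [← map_halfPlaneChart, lintegral_map hK measurable_halfPlaneChart, Measure.volume_eq_prod,
    lintegral_prod (fun p => K (halfPlaneChart p))
      (hK.comp measurable_halfPlaneChart).aemeasurable]

/-- The Möbius transformation `w ↦ s - 1 / w`. -/
def inversionMat (s : ℝ) : SL(2, ℝ) := ⟨!![s, -1; 1, 0], by simp [Matrix.det_fin_two_of]⟩

lemma horoChart_smul_I (s t r : ℝ) :
    horoChart s t r • UpperHalfPlane.I = inversionMat s • halfPlaneChart (t, r) := by
  apply UpperHalfPlane.ext
  have hpos := Real.exp_pos (-t / 2)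
  have hval : (horoChart s t r).val = !![Real.exp (t / 2) - r * s * Real.exp (-t / 2),
      s * Real.exp (-t / 2); -r * Real.exp (-t / 2), Real.exp (-t / 2)] := by
    rw [horoChart, Matrix.SpecialLinearGroup.coe_mul, nMat_mul_aMat_val, lowMat_apply,
      Matrix.mul_fin_two]
    ext i j
    fin_cases i <;> fin_cases j <;> simp <;> ring
  have h1 : Real.exp (-t) = Real.exp (-t / 2) * Real.exp (-t / 2) := by
    rw [← Real.exp_add]
    ring_nf
  have h2 : Real.exp (t / 2) = (Real.exp (-t / 2))⁻¹ := by
    rw [← Real.exp_neg]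
    ring_nf
  have hw : (halfPlaneChart (t, r) : ℂ) =
      (Real.exp (-t / 2) : ℂ) * Real.exp (-t / 2) * (r + Complex.I) := by
    rw [coe_halfPlaneChart, h1]
    generalize Real.exp (-t / 2) = e
    apply Complex.ext <;> simp
    ring
  have hri : (r : ℂ) + Complex.I ≠ 0 := by
    intro h
    simpa using congrArg Complex.im h
  have hri' : -(r : ℂ) * Complex.I + 1 ≠ 0 := by
    intro h
    simpa using congrArg Complex.re h
  have he : (Real.exp (-t / 2) : ℂ) ≠ 0 := by
    exact_mod_cast hpos.ne'
  rw [UpperHalfPlane.coe_specialLinearGroup_apply, UpperHalfPlane.coe_specialLinearGroup_apply, hw]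
  simp only [hval, h2, inversionMat, UpperHalfPlane.coe_I]
  generalize Real.exp (-t / 2) = e at he
  have hden : ((-r * e : ℝ) : ℂ) * Complex.I + (e : ℝ) ≠ 0 := by
    have : ((-r * e : ℝ) : ℂ) * Complex.I + (e : ℝ) = e * (-(r : ℂ) * Complex.I + 1) := by
      push_cast
      ring
    rw [this]
    exact mul_ne_zero he hri'
  simp
  rw [div_eq_div_iff (by simpa using hden) (by simp [he, hri])]
  field_simp
  ring_nf
  simp only [Complex.I_sq]
  ring

lemma lintegral_poisson_kernel (z : UpperHalfPlane) :
    ∫⁻ s : ℝ, ENNReal.ofReal (z.im / ((z.re - s) ^ 2 + z.im ^ 2)) = ENNReal.ofReal Real.pi := by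
  have hy := z.im_pos
  rw [← lintegral_add_right_eq_self _ z.re, lintegral_eq_ofReal_mul_lintegral_comp_mul
    (fun s => ENNReal.ofReal (z.im / ((z.re - (s + z.re)) ^ 2 + z.im ^ 2))) (by fun_prop) hy,
    ← lintegral_const_mul' _ _ (by simp), ← integral_univ_inv_one_add_sq,
    ofReal_integral_eq_lintegral_ofReal integrable_inv_one_add_sq
      (Filter.Eventually.of_forall fun x => by positivity)]
  refine lintegral_congr fun s => ?_
  rw [← ENNReal.ofReal_mul hy.le]
  congr 1
  have : z.re - (s * z.im + z.re) = -(s * z.im) := by ring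
  rw [this]
  field_simp
  ring

lemma im_inversionMat_inv_smul (s : ℝ) (z : UpperHalfPlane) :
    ((inversionMat s)⁻¹ • z).im = z.im / ((z.re - s) ^ 2 + z.im ^ 2) := by
  have hval : (inversionMat s)⁻¹.val = !![0, 1; -1, s] := by
    rw [Matrix.SpecialLinearGroup.coe_inv, inversionMat, Matrix.adjugate_fin_two_of]
    simp
  rw [← UpperHalfPlane.coe_im, UpperHalfPlane.coe_specialLinearGroup_apply]
  simp only [hval]
  simp [Complex.normSq_apply]
  congr 1
  ring

lemma measurable_smul_I : Measurable fun g : SL(2, ℝ) => g • UpperHalfPlane.I := by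
  rw [← UpperHalfPlane.measurableEmbedding_coe.measurable_comp_iff]
  have : (UpperHalfPlane.coe ∘ fun g : SL(2, ℝ) => g • UpperHalfPlane.I) = fun g : SL(2, ℝ) =>
      (((g 0 0 : ℝ) : ℂ) * Complex.I + ((g 0 1 : ℝ) : ℂ)) /
        (((g 1 0 : ℝ) : ℂ) * Complex.I + ((g 1 1 : ℝ) : ℂ)) := by
    funext g
    simp [UpperHalfPlane.coe_specialLinearGroup_apply]
  rw [this]
  fun_prop

lemma measurePreserving_smul_halfPlane (g : SL(2, ℝ)) :
    MeasurePreserving (fun z : UpperHalfPlane => g • z) :=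
  measurePreserving_smul (g : GL (Fin 2) ℝ) (volume : Measure UpperHalfPlane)

/-- The chart sends $i$ to $s-1/w$ with $w=e^{-t}(r+i)$. For fixed $s$ the weight $e^{-t}$ is
$\operatorname{Im}w$; moving to $z=s-1/w$ by invariance of area turns it into the Poisson kernel of
$z$ at $s$, whose integral over $s$ is $\pi$. -/
lemma setLIntegral_haarSL_smul_I {H : UpperHalfPlane → ℝ≥0∞} (hH : Measurable H) :
    ∫⁻ g in {g | 0 < g 1 1}, H (g • UpperHalfPlane.I) ∂haarSL =
      ENNReal.ofReal Real.pi * ∫⁻ z, H z := by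
  have hHI : Measurable fun g : SL(2, ℝ) => H (g • UpperHalfPlane.I) := hH.comp measurable_smul_I
  rw [setLIntegral_haarSL hHI]
  have hm1 : Measurable fun p : (ℝ × ℝ) × ℝ => H (horoChart p.1.2 p.1.1 p.2 • UpperHalfPlane.I) :=
    hHI.comp (by fun_prop)
  have hm2 : Measurable fun p : ℝ × ℝ =>
      ∫⁻ r, H (horoChart p.2 p.1 r • UpperHalfPlane.I) := hm1.lintegral_prod_right'
  have him : Measurable fun z : UpperHalfPlane => ENNReal.ofReal z.im :=
    (UpperHalfPlane.continuous_im.measurable).ennreal_ofReal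
  calc ∫⁻ t, ENNReal.ofReal (Real.exp (-t)) *
        ∫⁻ s, ∫⁻ r, H (horoChart s t r • UpperHalfPlane.I)
      = ∫⁻ t, ∫⁻ s, ENNReal.ofReal (Real.exp (-t)) *
          ∫⁻ r, H (horoChart s t r • UpperHalfPlane.I) := by
        refine lintegral_congr fun t => ?_
        rw [lintegral_const_mul' _ _ (by simp)]
    _ = ∫⁻ s, ∫⁻ t, ENNReal.ofReal (Real.exp (-t)) *
          ∫⁻ r, H (horoChart s t r • UpperHalfPlane.I) := by
        refine lintegral_lintegral_swap (Measurable.aemeasurable ?_)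
        unfold Function.uncurry
        fun_prop
    _ = ∫⁻ s, ∫⁻ z : UpperHalfPlane, ENNReal.ofReal z.im * H (inversionMat s • z) := by
        refine lintegral_congr fun s => ?_
        refine Eq.trans ?_ (lintegral_halfPlane (K := fun z => ENNReal.ofReal z.im *
          H (inversionMat s • z)) (him.mul (hH.comp
            (measurePreserving_smul_halfPlane (inversionMat s)).measurable))).symm
        refine lintegral_congr fun t => ?_
        rw [← lintegral_const_mul' _ _ (by simp)]
        refine lintegral_congr fun r => ?_
        rw [horoChart_smul_I]
        rfl
    _ = ∫⁻ s : ℝ, ∫⁻ z : UpperHalfPlane,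
          ENNReal.ofReal (z.im / ((z.re - s) ^ 2 + z.im ^ 2)) * H z := by
        refine lintegral_congr fun s => ?_
        have h := (measurePreserving_smul_halfPlane (inversionMat s)⁻¹).lintegral_comp
          (him.mul (hH.comp (measurePreserving_smul_halfPlane (inversionMat s)).measurable))
        refine h.symm.trans (lintegral_congr fun z => ?_)
        simp only [Pi.mul_apply, Function.comp_apply, smul_inv_smul, im_inversionMat_inv_smul]
    _ = ∫⁻ z : UpperHalfPlane, ∫⁻ s : ℝ,
          ENNReal.ofReal (z.im / ((z.re - s) ^ 2 + z.im ^ 2)) * H z := by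
        refine lintegral_lintegral_swap (Measurable.aemeasurable ?_)
        have h1 := UpperHalfPlane.continuous_im.measurable
        have h2 := UpperHalfPlane.continuous_re.measurable
        unfold Function.uncurry
        fun_prop
    _ = ENNReal.ofReal Real.pi * ∫⁻ z, H z := by
        rw [← lintegral_const_mul _ hH]
        refine lintegral_congr fun z => ?_
        rw [lintegral_mul_const _ (by fun_prop), lintegral_poisson_kernel]

end HalfPlane

/-! ### Lifting the fundamental domain from the half-plane to the group. -/

section FundamentalDomain

open scoped Pointwise

variable {Γ : Subgroup SL(2, ℝ)}

instance (Γ : Subgroup SL(2, ℝ)) : MeasurableConstSMul Γ SL(2, ℝ) :=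
  ⟨fun γ => measurable_sl_mul (measurable_const (a := (γ : SL(2, ℝ)))) measurable_id⟩

instance (Γ : Subgroup SL(2, ℝ)) : SMulInvariantMeasure Γ SL(2, ℝ) haarSL :=
  ⟨fun γ _ hs => (measurePreserving_mul_left (γ : SL(2, ℝ))).measure_preimage
    hs.nullMeasurableSet⟩

lemma countable_of_discreteTopology (Γ : Subgroup SL(2, ℝ)) [DiscreteTopology Γ] :
    Countable Γ := by
  have : SecondCountableTopology (Matrix (Fin 2) (Fin 2) ℝ) :=
    inferInstanceAs (SecondCountableTopology (Fin 2 → Fin 2 → ℝ))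
  have : SecondCountableTopology SL(2, ℝ) :=
    Topology.IsEmbedding.secondCountableTopology
      (f := (Subtype.val : SL(2, ℝ) → Matrix (Fin 2) (Fin 2) ℝ)) Topology.IsEmbedding.subtypeVal
  exact TopologicalSpace.separableSpace_iff_countable.1 inferInstance

lemma ae_one_one_ne_zero : ∀ᵐ g ∂haarSL, g 1 1 ≠ 0 := by
  refine Measure.ae_smul_measure ?_ 2
  refine (ae_map_iff (p := fun g : SL(2, ℝ) => g 1 1 ≠ 0) measurable_colChart.aemeasurable
    (measurableSet_eq_fun (measurable_entry 1 1) measurable_const).compl).2 ?_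
  refine Filter.Eventually.of_forall fun p => ?_
  change (if p.1.2 = 0 then (1 : ℝ) else p.1.2) ≠ 0
  split_ifs with h
  · exact one_ne_zero
  · exact h

lemma measurableSet_one_one_pos : MeasurableSet {g : SL(2, ℝ) | 0 < g 1 1} :=
  measurableSet_lt measurable_const (measurable_entry 1 1)

lemma map_smul_I_restrict_haarSL :
    Measure.map (fun g : SL(2, ℝ) => g • UpperHalfPlane.I) (haarSL.restrict {g | 0 < g 1 1}) =
      ENNReal.ofReal Real.pi • volume := by
  ext A hA
  have h := setLIntegral_haarSL_smul_I (measurable_one.indicator hA : Measurable (A.indicator 1))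
  rw [lintegral_indicator_one hA, ← lintegral_map (measurable_one.indicator hA) measurable_smul_I,
    lintegral_indicator_one hA] at h
  rw [h, Measure.smul_apply, smul_eq_mul]

lemma neg_apply_sl (g : SL(2, ℝ)) (i j : Fin 2) : (-1 * g) i j = -g i j := by
  rw [neg_one_mul]
  simp

lemma neg_one_mul_smul (g : SL(2, ℝ)) (z : UpperHalfPlane) : (-1 * g) • z = g • z := by
  apply UpperHalfPlane.ext
  rw [UpperHalfPlane.coe_specialLinearGroup_apply, UpperHalfPlane.coe_specialLinearGroup_apply]
  simp only [neg_apply_sl]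
  rw [← neg_div_neg_eq]
  simp only [Algebra.algebraMap_self, RingHom.id_apply, Complex.ofReal_neg]
  ring_nf

/-- The projection formula covers $d>0$; multiplication by $-1$, which acts trivially on $\mathbb
H$, carries it to $d<0$, and $d=0$ is null. -/
lemma quasiMeasurePreserving_smul_I : Measure.QuasiMeasurePreserving
    (fun g : SL(2, ℝ) => g • UpperHalfPlane.I) haarSL volume := by
  refine ⟨measurable_smul_I, Measure.AbsolutelyContinuous.mk fun N hN h0 => ?_⟩
  rw [Measure.map_apply measurable_smul_I hN]
  set P : Set SL(2, ℝ) := (fun g : SL(2, ℝ) => g • UpperHalfPlane.I) ⁻¹' N ∩ {g | 0 < g 1 1}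
  have hPm : MeasurableSet P := (measurable_smul_I hN).inter measurableSet_one_one_pos
  have hP : haarSL P = 0 := by
    rw [← Measure.restrict_apply (measurable_smul_I hN), ← Measure.map_apply measurable_smul_I hN,
      map_smul_I_restrict_haarSL, Measure.smul_apply, h0, smul_zero]
  have hP' : haarSL ((fun g => -1 * g) ⁻¹' P) = 0 := by
    rw [(measurePreserving_mul_left (-1)).measure_preimage hPm.nullMeasurableSet, hP]
  refine measure_mono_null (t := P ∪ (fun g => -1 * g) ⁻¹' P ∪ {g | ¬ g 1 1 ≠ 0}) ?_
    (measure_union_null (measure_union_null hP hP') (ae_iff.1 ae_one_one_ne_zero))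
  intro g hg
  rcases lt_trichotomy (g 1 1) 0 with h | h | h
  · refine Or.inl (Or.inr ⟨?_, ?_⟩)
    · change (-1 * g) • UpperHalfPlane.I ∈ N
      rw [neg_one_mul_smul]
      exact hg
    · change 0 < (-1 * g) 1 1
      rw [neg_apply_sl]
      linarith
  · exact Or.inr (not_not.2 h)
  · exact Or.inl (Or.inl ⟨hg, h⟩)

/-- The lift of a subset of the upper half-plane to `SL(2, ℝ)` modulo `-1`. -/
def liftSet (F : Set UpperHalfPlane) : Set SL(2, ℝ) :=
  (fun g : SL(2, ℝ) => g • UpperHalfPlane.I) ⁻¹' F ∩ {g | 0 < g 1 1}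

lemma haarSL_liftSet {F : Set UpperHalfPlane} (hF : NullMeasurableSet F) :
    haarSL (liftSet F) = ENNReal.ofReal Real.pi * volume F := by
  have h := map_smul_I_restrict_haarSL
  rw [liftSet, ← Measure.restrict_apply' measurableSet_one_one_pos,
    ← Measure.map_apply₀ measurable_smul_I.aemeasurable, h, Measure.smul_apply, smul_eq_mul]
  rw [h]
  exact hF.mono_ac Measure.smul_absolutelyContinuous

lemma eq_one_or_eq_neg_one_of_forall_smul {γ : SL(2, ℝ)}
    (h : ∀ z : UpperHalfPlane, γ • z = z) : γ = 1 ∨ γ = -1 := by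
  have key : ∀ y : ℝ, 0 < y → γ 0 0 = γ 1 1 ∧ γ 0 1 = -(γ 1 0 * y ^ 2) := by
    intro y hy
    have hz := congrArg UpperHalfPlane.coe (h ⟨⟨0, y⟩, hy⟩)
    rw [UpperHalfPlane.coe_specialLinearGroup_apply] at hz
    have hne : ((γ 1 0 : ℝ) : ℂ) * (⟨0, y⟩ : ℂ) + ((γ 1 1 : ℝ) : ℂ) ≠ 0 := by
      intro h0
      have h1 := congrArg Complex.re h0
      have h2 := congrArg Complex.im h0
      simp [hy.ne'] at h1 h2
      have := sl_det γ
      rw [h1, h2] at this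
      simp at this
    have hz' : ((γ 0 0 : ℝ) : ℂ) * (⟨0, y⟩ : ℂ) + ((γ 0 1 : ℝ) : ℂ) =
        (⟨0, y⟩ : ℂ) * (((γ 1 0 : ℝ) : ℂ) * (⟨0, y⟩ : ℂ) + ((γ 1 1 : ℝ) : ℂ)) :=
      (div_eq_iff hne).1 hz
    have h1 := congrArg Complex.re hz'
    have h2 := congrArg Complex.im hz'
    simp at h1 h2
    constructor
    · nlinarith [mul_right_cancel₀ hy.ne' (h2.trans (mul_comm _ _))]
    · rw [h1]
      ring
  -- Fixing both $i$ and $2i$ gives $b=-c$ and $b=-4c$, hence $b=c=0$.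
  obtain ⟨h1, h2⟩ := key 1 one_pos
  obtain ⟨-, h3⟩ := key 2 two_pos
  have hc : γ 1 0 = 0 := by linarith
  have hb : γ 0 1 = 0 := by
    rw [h2, hc]
    simp
  have hd := sl_det γ
  rw [h1, hb, zero_mul, sub_zero] at hd
  rcases mul_self_eq_one_iff.1 hd with hd | hd
  · left
    ext i j
    fin_cases i <;> fin_cases j <;> simp [hc, hb, hd, h1]
  · right
    ext i j
    fin_cases i <;> fin_cases j <;> simp [hc, hb, hd, h1]

/-- The condition $d>0$ selects one of each pair $\pm g$, which compensates for $-1\in\Gamma$ acting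
trivially on $\mathbb H$. -/
lemma isFundamentalDomain_liftSet [DiscreteTopology Γ] (hneg : (-1 : SL(2, ℝ)) ∈ Γ)
    {F : Set UpperHalfPlane} (hF : IsFundamentalDomain (moebiusGroup Γ) F) :
    IsFundamentalDomain Γ (liftSet F) haarSL := by
  have := countable_of_discreteTopology Γ
  refine IsFundamentalDomain.mk'' ?_ ?_ ?_ ?_
  · exact (hF.nullMeasurableSet.preimage quasiMeasurePreserving_smul_I).inter
      measurableSet_one_one_pos.nullMeasurableSet
  · have h1 : ∀ᵐ g ∂haarSL, ∀ γ : Γ, ((γ : SL(2, ℝ)) * g) 1 1 ≠ 0 := ae_all_iff.2 fun γ =>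
      (measurePreserving_mul_left (γ : SL(2, ℝ))).quasiMeasurePreserving.ae ae_one_one_ne_zero
    filter_upwards [h1, quasiMeasurePreserving_smul_I.ae hF.ae_covers] with g hg hcov
    obtain ⟨⟨_, γ, hγ, rfl⟩, hm⟩ := hcov
    replace hm : γ • g • UpperHalfPlane.I ∈ F := hm
    rcases lt_or_gt_of_ne (hg ⟨γ, hγ⟩) with h | h
    · refine ⟨⟨-1 * γ, Γ.mul_mem hneg hγ⟩, ?_, ?_⟩
      · change (-1 * γ * g) • UpperHalfPlane.I ∈ F
        rwa [mul_assoc, neg_one_mul_smul, mul_smul]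
      · change 0 < (-1 * γ * g) 1 1
        rw [mul_assoc, neg_apply_sl]
        exact neg_pos.2 h
    · refine ⟨⟨γ, hγ⟩, ?_, h⟩
      change (γ * g) • UpperHalfPlane.I ∈ F
      rwa [mul_smul]
  · rintro ⟨γ, hγ⟩ hne
    let m : moebiusGroup Γ := ⟨MulAction.toPermHom SL(2, ℝ) UpperHalfPlane γ, γ, hγ, rfl⟩
    by_cases hm : m = 1
    · have hγ1 : γ = -1 := by
        refine (eq_one_or_eq_neg_one_of_forall_smul fun z => ?_).resolve_left
          fun h => hne (Subtype.ext h)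
        exact congrArg (fun m : moebiusGroup Γ => m • z) hm
      refine Disjoint.aedisjoint (Set.disjoint_left.2 ?_)
      rintro _ ⟨g, hg, rfl⟩ hg'
      have h1 : 0 < g 1 1 := hg.2
      have h2 : 0 < (γ * g) 1 1 := hg'.2
      rw [hγ1, neg_apply_sl] at h2
      linarith
    · have hd : volume (m • F ∩ F) = 0 := by
        have : AEDisjoint volume (m • F) F := by
          simpa only [Function.onFun, one_smul] using hF.aedisjoint hm
        exact this
      refine measure_mono_null ?_ (quasiMeasurePreserving_smul_I.preimage_null hd)
      rintro _ ⟨⟨g, hg, rfl⟩, hg'⟩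
      refine ⟨⟨g • UpperHalfPlane.I, hg.1, ?_⟩, hg'.1⟩
      exact (mul_smul γ g UpperHalfPlane.I).symm
  · exact fun γ => (measurePreserving_mul_left (γ : SL(2, ℝ))).quasiMeasurePreserving

/-! ### Almost every orbit meets the section in nonpositive time. -/

/-- The set of `g` such that the horocycle orbit of `Γ g` does not meet the section in
nonpositive time. -/
def avoidSet (Γ : Subgroup SL(2, ℝ)) : Set SL(2, ℝ) :=
  {g | ∀ γ : Γ, ¬ ((0 < ((γ : SL(2, ℝ)) * g) 1 1 ∧ ((γ : SL(2, ℝ)) * g) 1 1 ≤ 1) ∧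
    ((γ : SL(2, ℝ)) * g) 1 0 ≤ 0)}

lemma measurableSet_avoidSet [DiscreteTopology Γ] : MeasurableSet (avoidSet Γ) := by
  have := countable_of_discreteTopology Γ
  have hm : ∀ (γ : Γ) i j, Measurable fun g : SL(2, ℝ) => ((γ : SL(2, ℝ)) * g) i j :=
    fun γ i j => (measurable_entry i j).comp (measurable_sl_mul measurable_const measurable_id)
  rw [avoidSet, Set.ofPred_forall]
  refine MeasurableSet.iInter fun γ => MeasurableSet.compl ?_
  exact ((measurableSet_lt measurable_const (hm γ 1 1)).inter
    (measurableSet_le (hm γ 1 1) measurable_const)).inter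
    (measurableSet_le (hm γ 1 0) measurable_const)

lemma smul_mem_avoidSet (γ : Γ) (g : SL(2, ℝ)) : γ • g ∈ avoidSet Γ ↔ g ∈ avoidSet Γ := by
  have hmul : ∀ δ : Γ, (δ : SL(2, ℝ)) * (γ • g) = ((δ * γ : Γ) : SL(2, ℝ)) * g := fun δ => by
    rw [Subgroup.smul_def, smul_eq_mul, Subgroup.coe_mul, mul_assoc]
  constructor
  · intro h δ
    have := h (δ * γ⁻¹)
    rwa [hmul, inv_mul_cancel_right] at this
  · intro h δ
    rw [hmul]
    exact h (δ * γ)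

/-- The forbidden region for bottom rows grows with $n$ and exhausts the half-plane $d>0$. -/
lemma mul_mem_avoidSet (g : SL(2, ℝ)) (n : ℕ) :
    g * lowMat (-n) * aMat (2 * n) ∈ avoidSet Γ ↔
      ∀ γ : Γ, ¬ ((0 < ((γ : SL(2, ℝ)) * g) 1 1 ∧ ((γ : SL(2, ℝ)) * g) 1 1 ≤ Real.exp n) ∧
        ((γ : SL(2, ℝ)) * g) 1 0 ≤ n * ((γ : SL(2, ℝ)) * g) 1 1) := by
  refine forall_congr' fun γ => not_congr ?_
  have hpos := Real.exp_pos (n : ℝ)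
  have he : Real.exp (-(2 * n) / 2) = (Real.exp (n : ℝ))⁻¹ := by
    rw [← Real.exp_neg]
    ring_nf
  rw [← mul_assoc, ← mul_assoc, mul_aMat_apply_one_one, mul_aMat_apply_one_zero,
    mul_lowMat_apply_one_one, mul_lowMat_apply_one_zero, he,
    show (2 * (n : ℝ)) / 2 = n by ring]
  refine and_congr (and_congr ?_ ?_) ?_
  · rw [mul_pos_iff_of_pos_left (inv_pos.2 hpos)]
  · rw [inv_mul_le_iff₀ hpos, mul_one]
  · rw [mul_nonpos_iff_pos_imp_nonpos]
    constructor
    · intro h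
      have := h.1 hpos
      linarith
    · intro h
      exact ⟨fun _ => by linarith, fun _ => hpos.le⟩

/-- The preimages under $R_n$ lie in the original set and have the same finite volume modulo
$\Gamma$, so almost every point lies in all of them. Such a point has no translate with $d>0$; the
translates by $\pm1$ then force $d=0$, a null condition. -/
lemma haarSL_avoidSet [DiscreteTopology Γ] (hneg : (-1 : SL(2, ℝ)) ∈ Γ) {W : Set SL(2, ℝ)}
    (hW : IsFundamentalDomain Γ W haarSL) (hfin : haarSL W ≠ ⊤) : haarSL (avoidSet Γ) = 0 := by
  have := countable_of_discreteTopology Γ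
  have hEm := measurableSet_avoidSet (Γ := Γ)
  refine hW.measure_zero_of_invariant _ (fun γ => ?_) ?_
  · ext g
    rw [Set.mem_smul_set_iff_inv_smul_mem, smul_mem_avoidSet]
  let R : ℕ → SL(2, ℝ) → SL(2, ℝ) := fun n g => g * lowMat (-n) * aMat (2 * n)
  have hR : ∀ n, MeasurePreserving (R n) haarSL haarSL := fun n =>
    (measurePreserving_mul_aMat (2 * n)).comp (measurePreserving_mul_lowMat (-n))
  have hRm : ∀ n, MeasurableSet (R n ⁻¹' avoidSet Γ) := fun n => (hR n).measurable hEm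
  have hsub : ∀ n, R n ⁻¹' avoidSet Γ ⊆ avoidSet Γ := by
    intro n g hg γ hγ
    refine (mul_mem_avoidSet g n).1 hg γ ⟨⟨hγ.1.1, hγ.1.2.trans ?_⟩, hγ.2.trans ?_⟩
    · exact Real.one_le_exp (Nat.cast_nonneg n)
    · exact mul_nonneg (Nat.cast_nonneg n) hγ.1.1.le
  have heq : ∀ n, haarSL (R n ⁻¹' avoidSet Γ ∩ W) = haarSL (avoidSet Γ ∩ W) := by
    intro n
    have hsc : ∀ (γ : Γ) g, R n (γ • g) = γ • R n g := by
      intro γ g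
      simp only [R, Subgroup.smul_def, smul_eq_mul, mul_assoc]
    have hW' : IsFundamentalDomain Γ (R n ⁻¹' W) haarSL :=
      -- Right translation commutes with $\Gamma$, so the preimage of $W$ is again a fundamental
      -- domain and invariant sets have equal measure in both.
      hW.preimage_of_equiv (hR n).quasiMeasurePreserving (e := id) Function.bijective_id hsc
    rw [hW.measure_set_eq hW' (hRm n), ← Set.preimage_inter, (hR n).measure_preimage
      (hEm.nullMeasurableSet.inter hW.nullMeasurableSet)]
    intro γ
    ext g
    rw [Set.mem_preimage, Set.mem_preimage, hsc, smul_mem_avoidSet, Set.mem_preimage]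
  have hdiff : ∀ n, haarSL ((avoidSet Γ ∩ W) \ (R n ⁻¹' avoidSet Γ ∩ W)) = 0 := by
    intro n
    rw [measure_sdiff (Set.inter_subset_inter_left _ (hsub n))
      ((hRm n).nullMeasurableSet.inter hW.nullMeasurableSet)
      (measure_ne_top_of_subset Set.inter_subset_right hfin), heq, tsub_self]
  refine measure_mono_null (t := (⋃ n, (avoidSet Γ ∩ W) \ (R n ⁻¹' avoidSet Γ ∩ W)) ∪
    {g | ¬ g 1 1 ≠ 0}) ?_ (measure_union_null (measure_iUnion_null hdiff)
      (ae_iff.1 ae_one_one_ne_zero))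
  rintro g ⟨hgE, hgW⟩
  by_contra hcon
  rw [Set.mem_union, not_or, Set.mem_iUnion, not_exists] at hcon
  obtain ⟨hcon, h0⟩ := hcon
  have hmem : ∀ n, R n g ∈ avoidSet Γ := by
    intro n
    by_contra h
    exact hcon n ⟨⟨hgE, hgW⟩, fun h' => h h'.1⟩
  have hle : ∀ γ : Γ, ((γ : SL(2, ℝ)) * g) 1 1 ≤ 0 := by
    intro γ
    by_contra hpos
    rw [not_le] at hpos
    obtain ⟨n, hn⟩ := exists_nat_ge (max (((γ : SL(2, ℝ)) * g) 1 1)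
      (((γ : SL(2, ℝ)) * g) 1 0 / ((γ : SL(2, ℝ)) * g) 1 1))
    refine (mul_mem_avoidSet g n).1 (hmem n) γ ⟨⟨hpos, ?_⟩, ?_⟩
    · have := Real.add_one_le_exp (n : ℝ)
      have := (le_max_left _ _).trans hn
      linarith
    · exact (div_le_iff₀ hpos).1 ((le_max_right _ _).trans hn)
  have h1 := hle 1
  have h2 := hle ⟨-1, hneg⟩
  rw [Subgroup.coe_one, one_mul] at h1
  change (-1 * g) 1 1 ≤ 0 at h2
  rw [neg_apply_sl] at h2
  exact h0 (fun h => h (by linarith))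

end FundamentalDomain

/-! ### The suspension as a fundamental domain, and its volume. -/

section Suspension

open scoped Pointwise

variable {Γ : Subgroup SL(2, ℝ)}

lemma HasWidthOneCuspAtInfinity.nMat_intCast_mem (h : HasWidthOneCuspAtInfinity Γ) (k : ℤ) :
    nMat k ∈ Γ := (h k).2 ⟨k, rfl⟩

lemma HasWidthOneCuspAtInfinity.nMat_one_mem (h : HasWidthOneCuspAtInfinity Γ) :
    nMat 1 ∈ Γ := (h 1).2 ⟨1, by simp⟩

/-- Conjugating $n(1)$ by an upper triangular element gives $n(d^2)$, so $d^2$ is an integer. The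
same holds for the inverse, and the two integers have product one. -/
lemma HasWidthOneCuspAtInfinity.exists_eq_nMat (h : HasWidthOneCuspAtInfinity Γ) {γ : SL(2, ℝ)}
    (hγ : γ ∈ Γ) (h0 : γ 1 0 = 0) (hpos : 0 < γ 1 1) : ∃ k : ℤ, γ = nMat k := by
  have key : ∀ δ ∈ Γ, δ 1 0 = 0 → ∃ k : ℤ, δ 1 1 ^ 2 = k := by
    intro δ hδ hδ0
    refine (h _).1 ?_
    have : δ⁻¹ * nMat 1 * δ = nMat (δ 1 1 ^ 2) := by
      apply Subtype.ext
      rw [inv_mul_nMat_one_mul_val, nMat_apply, hδ0]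
      simp
    rw [← this]
    exact Γ.mul_mem (Γ.mul_mem (Γ.inv_mem hδ) h.nMat_one_mem) hδ
  have hval : (γ⁻¹).val = !![γ 1 1, -γ 0 1; -γ 1 0, γ 0 0] := by
    rw [Matrix.SpecialLinearGroup.coe_inv, Matrix.adjugate_fin_two]
  obtain ⟨k, hk⟩ := key γ hγ h0
  obtain ⟨l, hl⟩ := key γ⁻¹ (Γ.inv_mem hγ) (by rw [hval]; simp [h0])
  have hl' : γ 0 0 ^ 2 = l := by
    rw [← hl, hval]
    simp
  have hd := sl_det γ
  rw [h0, mul_zero, sub_zero] at hd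
  have hkl : l * k = 1 := by
    have : (l : ℝ) * k = 1 := by rw [← hk, ← hl', ← mul_pow, hd, one_pow]
    exact_mod_cast this
  have hk0 : 0 ≤ k := by
    have : (0 : ℝ) ≤ k := hk ▸ sq_nonneg _
    exact_mod_cast this
  have hk1 : k = 1 := Int.eq_one_of_mul_eq_one_left hk0 hkl
  rw [hk1, Int.cast_one] at hk
  have h11 : γ 1 1 = 1 := by nlinarith
  have h00 : γ 0 0 = 1 := by rwa [h11, mul_one] at hd
  have hγn : γ = nMat (γ 0 1) := by
    ext i j
    fin_cases i <;> fin_cases j <;> simp [h0, h11, h00]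
  obtain ⟨m, hm⟩ := (h (γ 0 1)).1 (hγn ▸ hγ)
  exact ⟨m, by rw [← hm]; exact hγn⟩

/-- Since $\Gamma$ is countable, the return time is a countable infimum of measurable functions,
each the slope $c/d$ of one vector or $\infty$. -/
lemma measurable_returnTime [DiscreteTopology Γ] : Measurable (returnTime Γ) := by
  classical
  have := countable_of_discreteTopology Γ
  let k : Γ → ℝ × ℝ → SL(2, ℝ) := fun γ w => (γ : SL(2, ℝ)) * (nMat w.1 * aMat w.2)
  have hk : ∀ γ i j, Measurable fun w => k γ w i j := fun γ i j =>
    (measurable_entry i j).comp (measurable_sl_mul measurable_const (measurable_sl_mul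
      (measurable_nMat.comp measurable_fst) (measurable_aMat.comp measurable_snd)))
  have heq : returnTime Γ = fun w => ⨅ γ : Γ,
      if (0 < k γ w 1 1 ∧ k γ w 1 1 ≤ 1) ∧ 0 < k γ w 1 0
      then ENNReal.ofReal (k γ w 1 0 / k γ w 1 1) else ⊤ := by
    funext ⟨s, t⟩
    rw [returnTime_eq]
    apply le_antisymm
    · refine le_iInf fun γ => ?_
      split_ifs with h
      · refine sInf_le ⟨_, div_pos h.2 h.1.1, mem_hitTimes.2 ⟨γ, γ.2, ?_, h.1.1, h.1.2⟩, rfl⟩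
        exact (div_mul_cancel₀ _ h.1.1.ne').symm
      · exact le_top
    · refine le_sInf ?_
      rintro _ ⟨r, hr, hrH, rfl⟩
      obtain ⟨γ, hγ, h10, hpos, hle⟩ := mem_hitTimes.1 hrH
      refine (iInf_le _ ⟨γ, hγ⟩).trans ?_
      have hc : (0 < k ⟨γ, hγ⟩ (s, t) 1 1 ∧ k ⟨γ, hγ⟩ (s, t) 1 1 ≤ 1) ∧
          0 < k ⟨γ, hγ⟩ (s, t) 1 0 := by
        refine ⟨⟨hpos, hle⟩, ?_⟩
        change 0 < (γ * (nMat s * aMat t)) 1 0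
        rw [h10]
        exact mul_pos hr hpos
      rw [if_pos hc]
      refine ENNReal.ofReal_le_ofReal ?_
      change (γ * (nMat s * aMat t)) 1 0 / (γ * (nMat s * aMat t)) 1 1 ≤ r
      rw [h10, mul_div_cancel_right₀ _ hpos.ne']
  rw [heq]
  refine Measurable.iInf fun γ => Measurable.ite ?_ ((hk γ 1 0).div (hk γ 1 1)).ennreal_ofReal
    measurable_const
  exact ((measurableSet_lt measurable_const (hk γ 1 1)).inter
    (measurableSet_le (hk γ 1 1) measurable_const)).inter
    (measurableSet_lt measurable_const (hk γ 1 0))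

lemma horoChart_apply_one_one (s t r : ℝ) : horoChart s t r 1 1 = Real.exp (-t / 2) := by
  rw [horoChart, mul_lowMat_apply_one_one, nMat_mul_aMat_val]
  rfl

lemma coordT_horoChart (s t r : ℝ) : coordT (horoChart s t r) = t := by
  rw [coordT, horoChart_apply_one_one, Real.log_exp]
  ring

lemma coordR_horoChart (s t r : ℝ) : coordR (horoChart s t r) = r := by
  rw [coordR, horoChart_apply_one_one, horoChart, mul_lowMat_apply_one_zero, nMat_mul_aMat_val]
  simp

lemma coordS_horoChart (s t r : ℝ) : coordS (horoChart s t r) = s := by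
  rw [coordS, horoChart_apply_one_one, horoChart, Matrix.SpecialLinearGroup.coe_mul,
    nMat_mul_aMat_val, lowMat_apply, Matrix.mul_fin_two]
  simp

/-- The suspension of the section under the first return time, as a subset of `SL(2, ℝ)`. -/
def suspension (Γ : Subgroup SL(2, ℝ)) : Set SL(2, ℝ) :=
  {g | 0 < g 1 1 ∧ (coordS g, coordT g) ∈ paramSpace ∧ 0 ≤ coordR g ∧
    ENNReal.ofReal (coordR g) < returnTime Γ (coordS g, coordT g)}

lemma horoChart_mem_suspension {s t r : ℝ} : horoChart s t r ∈ suspension Γ ↔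
    (s, t) ∈ paramSpace ∧ 0 ≤ r ∧ ENNReal.ofReal r < returnTime Γ (s, t) := by
  change (0 < (horoChart s t r) 1 1 ∧ _) ↔ _
  rw [coordS_horoChart, coordT_horoChart, coordR_horoChart, horoChart_apply_one_one]
  exact and_iff_right (Real.exp_pos _)

lemma measurableSet_paramSpace : MeasurableSet paramSpace :=
  measurableSet_Ico.prod measurableSet_Ici

lemma measurableSet_suspension [DiscreteTopology Γ] : MeasurableSet (suspension Γ) := by
  have hS : Measurable coordS := (measurable_entry 0 1).div (measurable_entry 1 1)
  have hT : Measurable coordT := (measurable_entry 1 1).log.const_mul (-2)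
  have hR : Measurable coordR := (measurable_entry 1 0).neg.div (measurable_entry 1 1)
  exact measurableSet_one_one_pos.inter (((hS.prodMk hT) measurableSet_paramSpace).inter
    ((measurableSet_le measurable_const hR).inter
      (measurableSet_lt hR.ennreal_ofReal (measurable_returnTime.comp (hS.prodMk hT)))))

/-- This identifies $-r$ as the largest nonpositive hit time, a quantity depending only on $\Gamma
g$. -/
lemma hitTimes_of_mem_suspension [DiscreteTopology Γ] (h1 : nMat 1 ∈ Γ) {g : SL(2, ℝ)}
    (hg : g ∈ suspension Γ) : -coordR g ∈ hitTimes Γ g ∧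
      ∀ τ ∈ hitTimes Γ g, -coordR g < τ → 0 < τ := by
  obtain ⟨hpos, hw, hr, hlt⟩ := hg
  have hτ : ∀ τ, τ ∈ hitTimes Γ g ↔
      coordR g + τ ∈ hitTimes Γ (nMat (coordS g) * aMat (coordT g)) := by
    intro τ
    rw [← mem_hitTimes_mul_lowMat, nMat_mul_aMat_mul_lowMat_coord hpos]
  constructor
  · rw [hτ, add_neg_cancel, hitTimes, Set.mem_ofPred_eq, neg_zero, lowMat_zero, mul_one,
      mem_section_iff_exists]
    exact ⟨_, hw.2, _, 1, Γ.one_mem, one_mul _⟩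
  · intro τ hτH hlt'
    have := (lt_returnTime_iff h1 hr).1 hlt _ ((hτ τ).1 hτH) (by linarith)
    linarith

lemma eq_one_of_mul_mem_suspension [DiscreteTopology Γ] (hcusp : HasWidthOneCuspAtInfinity Γ)
    {g γ : SL(2, ℝ)} (hγ : γ ∈ Γ) (hg : g ∈ suspension Γ) (hg' : γ * g ∈ suspension Γ) :
    γ = 1 := by
  obtain ⟨hr, hmax⟩ := hitTimes_of_mem_suspension hcusp.nMat_one_mem hg
  obtain ⟨hr', hmax'⟩ := hitTimes_of_mem_suspension hcusp.nMat_one_mem hg'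
  rw [hitTimes_smul hγ] at hr' hmax'
  have h0 : 0 ≤ coordR g := hg.2.2.1
  have h0' : 0 ≤ coordR (γ * g) := hg'.2.2.1
  have hrr : coordR (γ * g) = coordR g := by
    rcases lt_trichotomy (coordR (γ * g)) (coordR g) with h | h | h
    · linarith [hmax _ hr' (by linarith)]
    · exact h
    · linarith [hmax' _ hr (by linarith)]
  have e1 := nMat_mul_aMat_mul_lowMat_coord hg.1
  have e2 := nMat_mul_aMat_mul_lowMat_coord hg'.1
  rw [hrr] at e2
  have e3 : γ * (nMat (coordS g) * aMat (coordT g)) =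
      nMat (coordS (γ * g)) * aMat (coordT (γ * g)) := by
    apply mul_right_cancel (b := lowMat (-coordR g))
    rw [e2, mul_assoc, e1]
  have hw := hg.2.1
  have hw' := hg'.2.1
  generalize coordS g = s, coordT g = t, coordS (γ * g) = s', coordT (γ * g) = t' at e3 hw hw'
  have hexp := Real.exp_pos (t / 2)
  have hexp2 := Real.exp_pos (-t / 2)
  have e4 : (γ * (nMat s * aMat t)).val = (nMat s' * aMat t').val := congrArg Subtype.val e3
  rw [Matrix.SpecialLinearGroup.coe_mul, nMat_mul_aMat_val, nMat_mul_aMat_val,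
    Matrix.eta_fin_two γ.val, Matrix.mul_fin_two] at e4
  have e10 := congrFun (congrFun e4 1) 0
  have e11 := congrFun (congrFun e4 1) 1
  simp at e10 e11
  rw [e10, zero_mul, zero_add] at e11
  have h11 : 0 < γ 1 1 := by
    have := Real.exp_pos (-t' / 2)
    rw [← e11] at this
    exact pos_of_mul_pos_left this hexp2.le
  obtain ⟨k, rfl⟩ := hcusp.exists_eq_nMat hγ e10 h11
  have e01 := congrFun (congrFun e4 0) 1
  simp at e01 e11
  rw [← e11, ← add_mul] at e01
  have hk : s + k = s' := mul_right_cancel₀ hexp2.ne' e01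
  -- Both $s$ and $s+k$ lie in $[0,1)$, so the integer $k$ vanishes.
  have hk1 : (k : ℝ) < 1 := by linarith [hw.1.1, hw'.1.2]
  have hk2 : (-1 : ℝ) < k := by linarith [hw.1.2, hw'.1.1]
  have hk3 : k < 1 := by exact_mod_cast hk1
  have hk4 : -1 < k := by exact_mod_cast hk2
  have : k = 0 := by omega
  rw [this, Int.cast_zero, nMat_zero]

lemma exists_mul_mem_suspension [DiscreteTopology Γ] (hcusp : HasWidthOneCuspAtInfinity Γ)
    {g : SL(2, ℝ)} (hg : g ∉ avoidSet Γ) : ∃ γ ∈ Γ, γ * g ∈ suspension Γ := by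
  obtain ⟨τ, hτ, hτ0⟩ : ∃ τ ∈ hitTimes Γ g, τ ≤ 0 := by
    rw [avoidSet, Set.mem_ofPred_eq, not_forall] at hg
    obtain ⟨γ, hγ⟩ := hg
    rw [not_not] at hγ
    exact ⟨_, mem_hitTimes.2 ⟨γ, γ.2, (div_mul_cancel₀ _ hγ.1.1.ne').symm, hγ.1.1, hγ.1.2⟩,
      div_nonpos_of_nonpos_of_nonneg hγ.2 hγ.1.1.le⟩
  have hfin : (hitTimes Γ g ∩ Set.Icc τ 0).Finite :=
    (finite_hitTimes_inter hcusp.nMat_one_mem g (-τ)).subset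
      (Set.inter_subset_inter_right _ (Set.Icc_subset_Icc (by simp) (by linarith)))
  -- The last hit time $\tau_0\le0$ supplies the height $r=-\tau_0$; an integer translation then
  -- brings $s$ into $[0,1)$.
  obtain ⟨τ₀, ⟨hτH, hτI⟩, hmax⟩ := Set.exists_max_image _ id hfin ⟨τ, hτ, le_rfl, hτ0⟩
  obtain ⟨t, ht, s, γ, hγ, he⟩ := mem_section_iff_exists.1 hτH
  have hmem : nMat ((-⌊s⌋ : ℤ) : ℝ) * γ ∈ Γ := Γ.mul_mem (hcusp.nMat_intCast_mem _) hγ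
  have he' : nMat ((-⌊s⌋ : ℤ) : ℝ) * γ * g * lowMat (-τ₀) = nMat (Int.fract s) * aMat t := by
    rw [mul_assoc, mul_assoc, ← mul_assoc γ, mul_assoc γ, he, ← mul_assoc, ← nMat_add]
    congr 2
    rw [Int.fract]
    push_cast
    ring
  refine ⟨_, hmem, ?_⟩
  have hchart : nMat ((-⌊s⌋ : ℤ) : ℝ) * γ * g = horoChart (Int.fract s) t (-τ₀) := by
    rw [horoChart, ← he', mul_assoc _ (lowMat _), ← lowMat_add, neg_neg, neg_add_cancel,
      lowMat_zero, mul_one]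
  rw [hchart, horoChart_mem_suspension]
  refine ⟨⟨⟨Int.fract_nonneg s, Int.fract_lt_one s⟩, ht⟩, by linarith [hτI.2], ?_⟩
  rw [lt_returnTime_iff hcusp.nMat_one_mem (by linarith [hτI.2])]
  intro r hr hpos
  rw [← he', mem_hitTimes_mul_lowMat, hitTimes_smul hmem] at hr
  by_contra hle
  have := hmax (τ₀ + r) ⟨hr, by linarith [hτI.1], by linarith⟩
  simp only [id] at this
  linarith

lemma isFundamentalDomain_suspension [DiscreteTopology Γ]
    (hcusp : HasWidthOneCuspAtInfinity Γ) (h0 : haarSL (avoidSet Γ) = 0) :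
    IsFundamentalDomain Γ (suspension Γ) haarSL := by
  refine IsFundamentalDomain.mk'' measurableSet_suspension.nullMeasurableSet ?_ ?_ ?_
  · filter_upwards [measure_eq_zero_iff_ae_notMem.1 h0] with g hg
    obtain ⟨γ, hγ, h⟩ := exists_mul_mem_suspension hcusp hg
    exact ⟨⟨γ, hγ⟩, h⟩
  · rintro ⟨γ, hγ⟩ hne
    refine Disjoint.aedisjoint (Set.disjoint_left.2 ?_)
    rintro _ ⟨g, hg, rfl⟩ hg'
    exact hne (Subtype.ext (eq_one_of_mul_mem_suspension hcusp hγ hg hg'))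
  · exact fun γ => (measurePreserving_mul_left (γ : SL(2, ℝ))).quasiMeasurePreserving

lemma volume_nonneg_ofReal_lt (a : ℝ≥0∞) :
    volume {r : ℝ | 0 ≤ r ∧ ENNReal.ofReal r < a} = a := by
  induction a with
  | top =>
    have : {r : ℝ | 0 ≤ r ∧ ENNReal.ofReal r < ⊤} = Set.Ici 0 := by
      ext r
      simp
    rw [this, Real.volume_Ici]
  | coe a =>
    have : {r : ℝ | 0 ≤ r ∧ ENNReal.ofReal r < a} = Set.Ico 0 (a : ℝ) := by
      ext r
      refine and_congr_right fun hr => ?_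
      rw [ENNReal.ofReal_lt_iff_lt_toReal hr ENNReal.coe_ne_top, ENNReal.coe_toReal]
    rw [this, Real.volume_Ico, sub_zero, ENNReal.ofReal_coe_nnreal]

/-- By Fubini, the fibre over $(s,t)\in\Sigma$ is $[0,\eta_1(s,t))$, of length $\eta_1(s,t)$ even
when this is infinite. -/
lemma haarSL_suspension [DiscreteTopology Γ] : haarSL (suspension Γ) = meanReturnTime Γ := by
  have hm := measurableSet_suspension (Γ := Γ)
  have hη := measurable_returnTime (Γ := Γ)
  have he : Measurable fun w : ℝ × ℝ => ENNReal.ofReal (Real.exp (-w.2)) := by fun_prop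
  have hm' : Measurable fun w : ℝ × ℝ => paramSpace.indicator
      (fun w => ENNReal.ofReal (Real.exp (-w.2)) * returnTime Γ w) w :=
    (he.mul hη).indicator measurableSet_paramSpace
  have h1 : haarSL (suspension Γ) =
      ∫⁻ g in {g | 0 < g 1 1}, (suspension Γ).indicator 1 g ∂haarSL := by
    rw [lintegral_indicator_one hm, Measure.restrict_apply hm]
    congr 1
    exact (Set.inter_eq_left.2 fun g hg => hg.1).symm
  rw [h1, setLIntegral_haarSL (measurable_one.indicator hm), meanReturnTime, nu,
    lintegral_withDensity_eq_lintegral_mul _ he hη, ← lintegral_indicator measurableSet_paramSpace,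
    Measure.volume_eq_prod]
  refine Eq.trans ?_ (lintegral_prod_symm _ hm'.aemeasurable).symm
  refine lintegral_congr fun t => ?_
  rw [← lintegral_const_mul' _ _ (by simp)]
  refine lintegral_congr fun s => ?_
  by_cases hw : (s, t) ∈ paramSpace
  · rw [Set.indicator_of_mem hw]
    congr 1
    have hset : ∀ r, (suspension Γ).indicator (1 : SL(2, ℝ) → ℝ≥0∞) (horoChart s t r) =
        {r : ℝ | 0 ≤ r ∧ ENNReal.ofReal r < returnTime Γ (s, t)}.indicator 1 r := by
      intro r
      have hiff : horoChart s t r ∈ suspension Γ ↔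
          r ∈ {r : ℝ | 0 ≤ r ∧ ENNReal.ofReal r < returnTime Γ (s, t)} :=
        horoChart_mem_suspension.trans (and_iff_right hw)
      by_cases h : horoChart s t r ∈ suspension Γ
      · rw [Set.indicator_of_mem h, Set.indicator_of_mem (hiff.1 h)]
        rfl
      · rw [Set.indicator_of_notMem h, Set.indicator_of_notMem (mt hiff.2 h)]
    simp only [hset]
    rw [lintegral_indicator_one, volume_nonneg_ofReal_lt]
    exact (measurableSet_le measurable_const measurable_id).inter
      (measurableSet_lt (measurable_id.ennreal_ofReal) measurable_const)
  · rw [Set.indicator_of_notMem hw]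
    have hset : ∀ r, (suspension Γ).indicator (1 : SL(2, ℝ) → ℝ≥0∞) (horoChart s t r) = 0 := by
      intro r
      rw [Set.indicator_of_notMem]
      rw [horoChart_mem_suspension]
      exact fun h => hw h.1
    simp only [hset, lintegral_zero, mul_zero]

lemma meanReturnTime_eq (hdisc : DiscreteTopology Γ) (hneg : (-1 : SL(2, ℝ)) ∈ Γ)
    (hcusp : HasWidthOneCuspAtInfinity Γ) {F : Set UpperHalfPlane}
    (hF : IsFundamentalDomain (moebiusGroup Γ) F) (hfin : volume F ≠ ⊤) :
    meanReturnTime Γ = ENNReal.ofReal Real.pi * volume F := by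
  have := countable_of_discreteTopology Γ
  have hW := isFundamentalDomain_liftSet hneg hF
  have hWvol := haarSL_liftSet hF.nullMeasurableSet
  have h0 := haarSL_avoidSet hneg hW (by rw [hWvol]; finiteness)
  rw [← haarSL_suspension, ← hWvol]
  exact (isFundamentalDomain_suspension hcusp h0).measure_eq hW

end Suspension

end Horocycle

theorem mainTheorem9 (Γ : Subgroup SL(2, ℝ)) (hdisc : DiscreteTopology Γ)
    (hneg : (-1 : SL(2, ℝ)) ∈ Γ) (hcusp : Horocycle.HasWidthOneCuspAtInfinity Γ)
    (F : Set UpperHalfPlane)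
    (hF : IsFundamentalDomain (Horocycle.moebiusGroup Γ) F (volume : Measure UpperHalfPlane))
    (hfin : (volume : Measure UpperHalfPlane) F ≠ ⊤) :
    (∀ r s t : ℝ, 0 < r → (s, t) ∈ Horocycle.paramSpace →
      Horocycle.limitDensity Γ r (s, t) =
        1 / (Horocycle.meanReturnTime Γ).toReal *
          Horocycle.ind (Horocycle.pointSet Γ (Horocycle.nMat s * Horocycle.aMat t) ∩
            Horocycle.negTriangle r = ∅)) ∧
    Measurable (Horocycle.returnTime Γ) ∧
    Horocycle.meanReturnTime Γ =
      ENNReal.ofReal Real.pi * (volume : Measure UpperHalfPlane) F := by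
  refine ⟨fun r s t hr _ => ?_, Horocycle.measurable_returnTime,
    Horocycle.meanReturnTime_eq hdisc hneg hcusp hF hfin⟩
  rw [Horocycle.limitDensity, Horocycle.lt_backReturnTime_iff hcusp.nMat_one_mem hr]
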